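/- Let $\Omega\subset\mathbb{R}^d$, $d\ge 1$, be a nonempty bounded open set and let $T>0$. Write $\|\cdot\|_\Omega$ and $(\cdot,\cdot)_\Omega$ for the norm and inner product of $L^2(\Omega)$ (scalar or vector valued). Let $H^1_0(\Omega)$ be the closure of $C_0^\infty(\Omega)$ in $H^1(\Omega)$, and let $H^{-1}(\Omega)$ be its dual, with duality pairing $\langle\cdot,\cdot\rangle$ and norm $\|\Phi\|_{H^{-1}(\Omega)}=\sup_{v\in H^1_0(\Omega)\setminus\{0\}}\langle\Phi,v\rangle/\|\nabla v\|_\Omega$; the space $L^2(\Omega)$ is embedded in $H^{-1}(\Omega)$ by $\langle w,v\rangle=(w,v)_\Omega$. Let $$X=L^2(0,T;H^1_0(\Omega)),\qquad \|v\|_X^2=\int_0^T\|\nabla v\|_\Omega^2\,dt,$$ $$Z=X\times L^2(\Omega),\qquad \|(v,v_T)\|_Z^2=\|v\|_X^2+\tfrac12\|v_T\|_\Omega^2,$$ $$Y=L^2(0,T;H^1_0(\Omega))\cap H^1(0,T;H^{-1}(\Omega)).$$ Every $\varphi\in Y$ has a representative in $C([0,T];L^2(\Omega))$, and $\varphi(0),\varphi(T)\in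 L^2(\Omega)$ denote the values of that representative. With $$\|\varphi\|_{Y^*}^2=\int_0^T\left(\|\partial_t\varphi\|_{H^{-1}(\Omega)}^2+\|\nabla\varphi\|_\Omega^2\right)dt+\|\varphi(0)\|_\Omega^2+\|\varphi(T)\|_\Omega^2\qquad(\varphi\in Y),$$ $$B_Z((v,v_T),\varphi)=(v_T,\varphi(T))_\Omega+\int_0^T\left(-\langle\partial_t\varphi,v\rangle+(\nabla\varphi,\nabla v)_\Omega\right)dt\qquad((v,v_T)\in Z,\ \varphi\in Y),$$ the following identities hold: $$\sup_{\varphi\in Y\setminus\{0\}}\frac{B_Z(\boldsymbol v,\varphi)}{\|\varphi\|_{Y^*}}=\|\boldsymbol v\|_Z\quad\text{for all }\boldsymbol v\in Z,$$ $$\sup_{\boldsymbol v\in Z\setminus\{0\}}\frac{B_Z(\boldsymbol v,\varphi)}{\|\boldsymbol v\|_Z}=\|\varphi\|_{Y^*}\quad\text{for all }\varphi\in Y.$$ Consequently, let $f\in L^2(0,T;H^{-1}(\Omega))$ and $u_0\in L^2(\Omega)$, and let $u\in Y$ be a weak solution of the heat equation $\partial_t u-\Delta u=f$ with homogeneous Dirichlet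 condition, that is, $u(0)=u_0$ and, for every $v\in H^1_0(\Omega)$, $\langle\partial_t u(t),v\rangle+(\nabla u(t),\nabla v)_\Omega=\langle f(t),v\rangle$ for a.e. $t\in(0,T)$. Then its energy norm, defined by $\|u\|_E^2=\tfrac12\|u(T)\|_\Omega^2+\int_0^T\|\nabla u\|_\Omega^2\,dt$, satisfies $$\|u\|_E=\|(u,u(T))\|_Z=\sup_{\varphi\in Y\setminus\{0\}}\frac{\int_0^T\langle f,\varphi\rangle\,dt+(u_0,\varphi(0))_\Omega}{\|\varphi\|_{Y^*}}.$$ -/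

import Mathlib

open MeasureTheory Set
open scoped ContDiff

noncomputable section

namespace HeatEnergy

/-- `ℝ^d` with the Euclidean norm. -/
abbrev E (d : ℕ) : Type := EuclideanSpace ℝ (Fin d)

/-- `φ ∈ C₀^∞(U)`: smooth on the whole space, with compact support contained in `U`. -/
structure IsTest {V : Type*} [NormedAddCommGroup V] [NormedSpace ℝ V]
    (U : Set V) (φ : V → ℝ) : Prop where
  smooth : ContDiff ℝ ∞ φ
  compact : HasCompactSupport φ
  supp : tsupport φ ⊆ U

/-- The partial derivative `∂φ/∂xᵢ`. -/
def partialDeriv {d : ℕ} (i : Fin d) (φ : E d → ℝ) (x : E d) : ℝ :=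
  fderiv ℝ φ x (EuclideanSpace.single i 1)

/-- The scalar space `L²(Ω)`. -/
abbrev L2 {d : ℕ} (Ω : Set (E d)) : Type := Lp ℝ 2 (volume.restrict Ω)

/-- The space `L²(Ω; ℝ^d)` of square-integrable vector fields. -/
abbrev L2vec {d : ℕ} (Ω : Set (E d)) : Type := Lp (E d) 2 (volume.restrict Ω)

/-- `g` is the weak gradient of `u` on `Ω`. -/
def IsWeakGrad {d : ℕ} (Ω : Set (E d)) (u : L2 Ω) (g : L2vec Ω) : Prop :=
  ∀ φ : E d → ℝ, IsTest Ω φ → ∀ i : Fin d,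
    ∫ x in Ω, u x * partialDeriv i φ x = -∫ x in Ω, g x i * φ x

theorem IsTest.memLp {V : Type*} [NormedAddCommGroup V] [NormedSpace ℝ V] [MeasurableSpace V]
    [BorelSpace V] [SecondCountableTopology V] {U : Set V} {φ : V → ℝ} (h : IsTest U φ)
    (μ : Measure V) [IsFiniteMeasureOnCompacts μ] : MemLp φ 2 μ :=
  h.smooth.continuous.memLp_of_hasCompactSupport h.compact

theorem IsTest.partial_memLp {d : ℕ} {U : Set (E d)} {φ : E d → ℝ} (h : IsTest U φ)
    (i : Fin d) (μ : Measure (E d)) [IsFiniteMeasureOnCompacts μ] :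
    MemLp (partialDeriv i φ) 2 μ := by
  apply Continuous.memLp_of_hasCompactSupport
  · exact (h.smooth.continuous_fderiv (by simp)).clm_apply continuous_const
  · exact h.compact.fderiv_apply ℝ _

theorem coord_memLp {d : ℕ} {Ω : Set (E d)} (g : L2vec Ω) (i : Fin d) :
    MemLp (fun x => g x i) 2 (volume.restrict Ω) :=
  (EuclideanSpace.proj (𝕜 := ℝ) i : E d →L[ℝ] ℝ).comp_memLp' (Lp.memLp g)

/-- The Hilbert space `H¹(Ω)`, realised as the space of pairs `(u, ∇u) ∈ L²(Ω) × L²(Ω; ℝ^d)` in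
which the second entry is the (unique) weak gradient of the first. The inherited norm satisfies
`‖u‖² = ‖u‖²_{L²} + ‖∇u‖²_{L²}`. -/
def H1 {d : ℕ} (Ω : Set (E d)) : Submodule ℝ (WithLp 2 (L2 Ω × L2vec Ω)) where
  carrier := {p | IsWeakGrad Ω p.fst p.snd}
  zero_mem' := by
    intro φ _ i
    have h1 : ∫ x in Ω, (0 : L2 Ω) x * partialDeriv i φ x = 0 := by
      apply integral_eq_zero_of_ae
      filter_upwards [Lp.coeFn_zero ℝ 2 (volume.restrict Ω)] with x hx
      rw [hx]; simp
    have h2 : ∫ x in Ω, (0 : L2vec Ω) x i * φ x = 0 := by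
      apply integral_eq_zero_of_ae
      filter_upwards [Lp.coeFn_zero (E d) 2 (volume.restrict Ω)] with x hx
      rw [hx]; simp
    exact h1.trans (by rw [← neg_zero]; exact congrArg _ h2.symm)
  add_mem' := by
    intro p q hp hq φ hφ i
    have h1 : ∫ x in Ω, (p + q).fst x * partialDeriv i φ x
        = (∫ x in Ω, p.fst x * partialDeriv i φ x) + ∫ x in Ω, q.fst x * partialDeriv i φ x := by
      have hi (w : L2 Ω) : Integrable (fun x => w x * partialDeriv i φ x) (volume.restrict Ω) :=
        (Lp.memLp w).integrable_mul (hφ.partial_memLp i _)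
      rw [← integral_add (hi p.fst) (hi q.fst)]
      apply integral_congr_ae
      filter_upwards [Lp.coeFn_add p.fst q.fst] with x hx
      rw [WithLp.add_fst, hx, Pi.add_apply, add_mul]
    have h2 : ∫ x in Ω, (p + q).snd x i * φ x
        = (∫ x in Ω, p.snd x i * φ x) + ∫ x in Ω, q.snd x i * φ x := by
      have hi (g : L2vec Ω) : Integrable (fun x => g x i * φ x) (volume.restrict Ω) :=
        (coord_memLp g i).integrable_mul (hφ.memLp _)
      rw [← integral_add (hi p.snd) (hi q.snd)]
      apply integral_congr_ae
      filter_upwards [Lp.coeFn_add p.snd q.snd] with x hx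
      rw [WithLp.add_snd, hx, Pi.add_apply, PiLp.add_apply, add_mul]
    rw [h1, h2, hp φ hφ i, hq φ hφ i, neg_add]
  smul_mem' := by
    intro c p hp φ hφ i
    have h1 : ∫ x in Ω, (c • p).fst x * partialDeriv i φ x
        = c * ∫ x in Ω, p.fst x * partialDeriv i φ x := by
      rw [← integral_const_mul]
      apply integral_congr_ae
      filter_upwards [Lp.coeFn_smul c p.fst] with x hx
      simp [hx, mul_assoc]
    have h2 : ∫ x in Ω, (c • p).snd x i * φ x = c * ∫ x in Ω, p.snd x i * φ x := by
      rw [← integral_const_mul]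
      apply integral_congr_ae
      filter_upwards [Lp.coeFn_smul c p.snd] with x hx
      simp [hx, mul_assoc]
    rw [h1, h2, hp φ hφ i, mul_neg]

/-- The elements of `H¹(Ω)` that are represented by a function in `C₀^∞(Ω)`. -/
def testSubspace {d : ℕ} (Ω : Set (E d)) : Submodule ℝ (H1 Ω) where
  carrier := {u | ∃ φ : E d → ℝ, IsTest Ω φ ∧ u.1.fst =ᵐ[volume.restrict Ω] φ}
  zero_mem' := ⟨0, ⟨contDiff_const, HasCompactSupport.zero, by simp [tsupport]⟩,
    Lp.coeFn_zero ℝ 2 (volume.restrict Ω)⟩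
  add_mem' := by
    rintro u w ⟨φ, hφ, hu⟩ ⟨ψ, hψ, hw⟩
    refine ⟨φ + ψ, ⟨hφ.smooth.add hψ.smooth, hφ.compact.add hψ.compact,
      (tsupport_add φ ψ).trans (union_subset hφ.supp hψ.supp)⟩, ?_⟩
    exact (Lp.coeFn_add u.1.fst w.1.fst).trans (hu.add hw)
  smul_mem' := by
    rintro c u ⟨φ, hφ, hu⟩
    refine ⟨c • φ, ⟨hφ.smooth.const_smul c, hφ.compact.smul_left,
      (tsupport_smul_subset_right (fun _ => c) φ).trans hφ.supp⟩, ?_⟩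
    exact (Lp.coeFn_smul c u.1.fst).trans (hu.const_smul c)

/-- `H¹₀(Ω)` as a subspace of `H¹(Ω)`: the closure of `C₀^∞(Ω)` in `H¹(Ω)`. -/
def h10Subspace {d : ℕ} (Ω : Set (E d)) : Submodule ℝ (H1 Ω) := (testSubspace Ω).topologicalClosure

/-- The space `H¹₀(Ω)`, with the inner product and norm inherited from `H¹(Ω)`. -/
def H10 {d : ℕ} (Ω : Set (E d)) : Type := h10Subspace Ω

instance {d : ℕ} (Ω : Set (E d)) : NormedAddCommGroup (H10 Ω) :=
  inferInstanceAs (NormedAddCommGroup (h10Subspace Ω))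

instance {d : ℕ} (Ω : Set (E d)) : InnerProductSpace ℝ (H10 Ω) :=
  inferInstanceAs (InnerProductSpace ℝ (h10Subspace Ω))

/-- The inclusion `H¹₀(Ω) → L²(Ω)`. -/
def toL2 {d : ℕ} (Ω : Set (E d)) : H10 Ω →L[ℝ] L2 Ω :=
  (WithLp.fstL 2 ℝ (L2 Ω) (L2vec Ω)).comp ((H1 Ω).subtypeL.comp (h10Subspace Ω).subtypeL)

/-- The weak gradient `∇ : H¹₀(Ω) → L²(Ω; ℝ^d)`. -/
def grad {d : ℕ} (Ω : Set (E d)) : H10 Ω →L[ℝ] L2vec Ω :=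
  (WithLp.sndL 2 ℝ (L2 Ω) (L2vec Ω)).comp ((H1 Ω).subtypeL.comp (h10Subspace Ω).subtypeL)

/-- `H⁻¹(Ω)`, the topological dual of `H¹₀(Ω)`. -/
abbrev Hm1 {d : ℕ} (Ω : Set (E d)) : Type := StrongDual ℝ (H10 Ω)

/-- The norm `‖Φ‖_{H⁻¹} = sup_{v ≠ 0} ⟨Φ, v⟩ / ‖∇v‖`. (The operator norm which `Hm1 Ω` carries as
an instance is taken with respect to the full `H¹`-norm; it is equivalent, and it is used below only
to define strong measurability, square integrability and Bochner integrals.) -/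
def hm1Norm {d : ℕ} {Ω : Set (E d)} (Φ : Hm1 Ω) : ℝ :=
  sSup {r : ℝ | ∃ v : H10 Ω, v ≠ 0 ∧ r = Φ v / ‖grad Ω v‖}

/-- The embedding `H¹₀(Ω) → L²(Ω) → H⁻¹(Ω)`, `⟨w, v⟩ = (w, v)_Ω`. -/
def toHm1 {d : ℕ} (Ω : Set (E d)) : H10 Ω →L[ℝ] Hm1 Ω :=
  (ContinuousLinearMap.precomp ℝ (toL2 Ω)).comp ((innerSL ℝ (E := L2 Ω)).comp (toL2 Ω))

theorem toHm1_apply {d : ℕ} (Ω : Set (E d)) (w v : H10 Ω) :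
    toHm1 Ω w v = inner ℝ (toL2 Ω w) (toL2 Ω v) := rfl

/-- The Bochner space `L²(0,T;V)`. -/
abbrev L2t (T : ℝ) (V : Type*) [NormedAddCommGroup V] : Type _ :=
  Lp V 2 (volume.restrict (Ioo 0 T))

/-- `X = L²(0,T;H¹₀(Ω))`. -/
abbrev X {d : ℕ} (Ω : Set (E d)) (T : ℝ) : Type := L2t T (H10 Ω)

/-- `‖v‖_X = (∫₀ᵀ ‖∇v‖² dt)^{1/2}`. -/
def xNorm {d : ℕ} {Ω : Set (E d)} {T : ℝ} (v : X Ω T) : ℝ :=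
  Real.sqrt (∫ t in Ioo 0 T, ‖grad Ω (v t)‖ ^ 2)

/-- `w ∈ L²(0,T;H⁻¹(Ω))` is the weak time derivative of `φ ∈ L²(0,T;H¹₀(Ω))`, the latter being
viewed as a function with values in `H⁻¹(Ω)`. The integrals are `H⁻¹(Ω)`-valued. -/
def IsWeakTimeDeriv {d : ℕ} {Ω : Set (E d)} {T : ℝ} (φ : X Ω T) (w : L2t T (Hm1 Ω)) : Prop :=
  ∀ η : ℝ → ℝ, IsTest (Ioo 0 T) η →
    ∫ t in Ioo 0 T, deriv η t • toHm1 Ω (φ t) = -∫ t in Ioo 0 T, η t • w t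

theorem IsTest.deriv_memLp {U : Set ℝ} {η : ℝ → ℝ} (h : IsTest U η)
    (μ : Measure ℝ) [IsFiniteMeasureOnCompacts μ] : MemLp (deriv η) 2 μ :=
  (h.smooth.continuous_deriv (by simp)).memLp_of_hasCompactSupport h.compact.deriv

theorem integrable_smul_of_memLp {V : Type*} [NormedAddCommGroup V] [NormedSpace ℝ V]
    {μ : Measure ℝ} {η : ℝ → ℝ} {f : ℝ → V} (hη : MemLp η 2 μ) (hf : MemLp f 2 μ) :
    Integrable (fun t => η t • f t) μ :=
  memLp_one_iff_integrable.1 (hf.smul hη)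

/-- `Y = L²(0,T;H¹₀(Ω)) ∩ H¹(0,T;H⁻¹(Ω))`, realised as the space of pairs `(φ, ∂ₜφ)` in
`L²(0,T;H¹₀(Ω)) × L²(0,T;H⁻¹(Ω))` in which the second entry is the (unique) weak time derivative of
the first. -/
def Y {d : ℕ} (Ω : Set (E d)) (T : ℝ) : Submodule ℝ (X Ω T × L2t T (Hm1 Ω)) where
  carrier := {p | IsWeakTimeDeriv p.1 p.2}
  zero_mem' := by
    intro η _
    have h1 : ∫ t in Ioo 0 T, deriv η t • toHm1 Ω ((0 : X Ω T) t) = 0 := by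
      apply integral_eq_zero_of_ae
      filter_upwards [Lp.coeFn_zero (H10 Ω) 2 (volume.restrict (Ioo 0 T))] with t ht
      rw [ht]; simp
    have h2 : ∫ t in Ioo 0 T, η t • (0 : L2t T (Hm1 Ω)) t = 0 := by
      apply integral_eq_zero_of_ae
      filter_upwards [Lp.coeFn_zero (Hm1 Ω) 2 (volume.restrict (Ioo 0 T))] with t ht
      rw [ht]; simp
    exact h1.trans (by rw [← neg_zero]; exact congrArg _ h2.symm)
  add_mem' := by
    intro p q hp hq η hη
    have h1 : ∫ t in Ioo 0 T, deriv η t • toHm1 Ω ((p + q).1 t)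
        = (∫ t in Ioo 0 T, deriv η t • toHm1 Ω (p.1 t))
          + ∫ t in Ioo 0 T, deriv η t • toHm1 Ω (q.1 t) := by
      have hi (f : X Ω T) : Integrable (fun t => deriv η t • toHm1 Ω (f t))
          (volume.restrict (Ioo 0 T)) :=
        integrable_smul_of_memLp (hη.deriv_memLp _) ((toHm1 Ω).comp_memLp' (Lp.memLp f))
      rw [← integral_add (hi p.1) (hi q.1)]
      apply integral_congr_ae
      filter_upwards [Lp.coeFn_add p.1 q.1] with t ht
      rw [Prod.fst_add, ht, Pi.add_apply, map_add, smul_add]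
    have h2 : ∫ t in Ioo 0 T, η t • (p + q).2 t
        = (∫ t in Ioo 0 T, η t • p.2 t) + ∫ t in Ioo 0 T, η t • q.2 t := by
      rw [← integral_add (integrable_smul_of_memLp (hη.memLp _) (Lp.memLp p.2))
        (integrable_smul_of_memLp (hη.memLp _) (Lp.memLp q.2))]
      apply integral_congr_ae
      filter_upwards [Lp.coeFn_add p.2 q.2] with t ht
      rw [Prod.snd_add, ht, Pi.add_apply, smul_add]
    rw [h1, h2, hp η hη, hq η hη, neg_add]
  smul_mem' := by
    intro c p hp η hη
    have h1 : ∫ t in Ioo 0 T, deriv η t • toHm1 Ω ((c • p).1 t)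
        = c • ∫ t in Ioo 0 T, deriv η t • toHm1 Ω (p.1 t) := by
      rw [← integral_smul]
      apply integral_congr_ae
      filter_upwards [Lp.coeFn_smul c p.1] with t ht
      simp [ht, smul_comm c]
    have h2 : ∫ t in Ioo 0 T, η t • (c • p).2 t = c • ∫ t in Ioo 0 T, η t • p.2 t := by
      rw [← integral_smul]
      apply integral_congr_ae
      filter_upwards [Lp.coeFn_smul c p.2] with t ht
      simp [ht, smul_comm c]
    rw [h1, h2, hp η hη, smul_neg]

/-- The element of `X` underlying `φ ∈ Y`. -/
abbrev incl {d : ℕ} {Ω : Set (E d)} {T : ℝ} (φ : Y Ω T) : X Ω T := φ.1.1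

/-- The weak time derivative `∂ₜφ ∈ L²(0,T;H⁻¹(Ω))` of `φ ∈ Y`. -/
abbrev dt {d : ℕ} {Ω : Set (E d)} {T : ℝ} (φ : Y Ω T) : L2t T (Hm1 Ω) := φ.1.2

/-- `c` is a representative of `φ` in `C([0,T];L²(Ω))`. -/
def IsContRep {d : ℕ} {Ω : Set (E d)} {T : ℝ} (φ : Y Ω T) (c : ℝ → L2 Ω) : Prop :=
  ContinuousOn c (Icc 0 T) ∧ ∀ᵐ t ∂(volume.restrict (Ioo 0 T)), c t = toL2 Ω (incl φ t)

open Classical in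
/-- The value `φ(s) ∈ L²(Ω)` at `s ∈ [0,T]` of the continuous representative of `φ ∈ Y`. -/
def valAt {d : ℕ} {Ω : Set (E d)} {T : ℝ} (φ : Y Ω T) (s : ℝ) : L2 Ω :=
  if h : ∃ c : ℝ → L2 Ω, IsContRep φ c then h.choose s else 0

/-- The time-reversal-invariant norm on `Y`,
`‖φ‖²_{Y*} = ∫₀ᵀ (‖∂ₜφ‖²_{H⁻¹} + ‖∇φ‖²) dt + ‖φ(0)‖² + ‖φ(T)‖²`. -/
def ysNorm {d : ℕ} {Ω : Set (E d)} {T : ℝ} (φ : Y Ω T) : ℝ :=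
  Real.sqrt ((∫ t in Ioo 0 T, (hm1Norm (dt φ t) ^ 2 + ‖grad Ω (incl φ t)‖ ^ 2))
    + ‖valAt φ 0‖ ^ 2 + ‖valAt φ T‖ ^ 2)

/-- `Z = X × L²(Ω)`. -/
abbrev Z {d : ℕ} (Ω : Set (E d)) (T : ℝ) : Type := X Ω T × L2 Ω

/-- `‖(v, v_T)‖²_Z = ‖v‖²_X + ½ ‖v_T‖²`. -/
def zNorm {d : ℕ} {Ω : Set (E d)} {T : ℝ} (v : Z Ω T) : ℝ :=
  Real.sqrt (xNorm v.1 ^ 2 + (1 / 2) * ‖v.2‖ ^ 2)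

/-- `B_Z((v, v_T), φ) = (v_T, φ(T)) + ∫₀ᵀ (-⟨∂ₜφ, v⟩ + (∇φ, ∇v)) dt`. -/
def BZ {d : ℕ} {Ω : Set (E d)} {T : ℝ} (v : Z Ω T) (φ : Y Ω T) : ℝ :=
  inner ℝ v.2 (valAt φ T)
    + ∫ t in Ioo 0 T, (-(dt φ t) (v.1 t) + inner ℝ (grad Ω (incl φ t)) (grad Ω (v.1 t)))

/-- `u ∈ Y` is a weak solution of `∂ₜu - Δu = f`, `u = 0` on `∂Ω`, `u(0) = u₀`. -/
def IsHeatSolution {d : ℕ} {Ω : Set (E d)} {T : ℝ} (f : L2t T (Hm1 Ω)) (u₀ : L2 Ω)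
    (u : Y Ω T) : Prop :=
  (∀ v : H10 Ω, ∀ᵐ t ∂(volume.restrict (Ioo 0 T)),
    (dt u t) v + inner ℝ (grad Ω (incl u t)) (grad Ω v) = (f t) v) ∧ valAt u 0 = u₀

/-- The energy norm, `‖u‖²_E = ½ ‖u(T)‖² + ∫₀ᵀ ‖∇u‖² dt`. -/
def energyNorm {d : ℕ} {Ω : Set (E d)} {T : ℝ} (u : Y Ω T) : ℝ :=
  Real.sqrt ((1 / 2) * ‖valAt u T‖ ^ 2 + ∫ t in Ioo 0 T, ‖grad Ω (incl u t)‖ ^ 2)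

end HeatEnergy

end

/-!
The two identities express that `B_Z` is, up to isometries, an inner product. Write `A = -Δ` for the
Riesz isomorphism `H¹₀(Ω) → H⁻¹(Ω)` of the inner product `(∇·, ∇·)`, which exists by the Poincaré
inequality and makes `‖Φ‖_{H⁻¹} = ‖∇A⁻¹Φ‖`. Then
`B_Z((v, v_T), φ) = ((v, v_T), Rφ)_Z` with `Rφ = (φ - A⁻¹∂ₜφ, 2φ(T))` (`BZ_eq_inner`), and
`‖Rφ‖_Z² = ∫ (‖∇φ‖² + ‖∂ₜφ‖²_{H⁻¹} - 2⟨∂ₜφ, φ⟩) dt + 2‖φ(T)‖²`. Since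
`2 ∫ ⟨∂ₜφ, φ⟩ dt = ‖φ(T)‖² - ‖φ(0)‖²`, this is `‖φ‖²_{Y*}` (`norm_zEmb_riesz`). The second identity
is then the Cauchy–Schwarz inequality, attained at `Rφ`. The first one needs in addition that the
range of `R` is dense in `Z` (`zEmb_mem_closure_range`): an annihilator `(v, v_T)` of `B_Z`
satisfies `∂ₜv = -Av` with `v(0) = 0` and `v(T) = v_T`, so that it vanishes by the energy identity
(`eq_zero_of_BZ_eq_zero`). For a solution `u` of the heat equation, integration by parts in time
identifies `B_Z((u, u(T)), ·)` with the data functional (`IsHeatSolution.BZ_eq`), and the formula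
for the energy norm is the first identity.

The analytic core is the Lions–Magenes lemma (`exists_continuousOn_rep`), which supplies the traces
`φ(0)`, `φ(T)` and the integration by parts formula. With `J : V → H` the embedding and `K = J†J`,
an element `u` of `L²(0,T;V)` with derivative in `L²(0,T;V')` is regularized by the operators
`(K + ε)⁻¹ K` acting on `V` instead of by mollification in time. Identifying `V'` with `V`, the
function `K u` is absolutely continuous with values in `V`, hence so is `(K + ε)⁻¹ K u`. The energy
identity is elementary for these functions, and it shows both that they converge uniformly in `H`
and that it passes to the limit.
-/

namespace HeatEnergy

/-! ### Functions of time with an integrable weak derivative -/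

/-- Exchanging the order of integration over the triangle `0 < s < t < T`. -/
theorem integral_primitive_swap {E₁ E₂ G : Type*} [NormedAddCommGroup E₁] [NormedSpace ℝ E₁]
    [CompleteSpace E₁] [NormedAddCommGroup E₂] [NormedSpace ℝ E₂] [CompleteSpace E₂]
    [NormedAddCommGroup G] [NormedSpace ℝ G] [CompleteSpace G] (L : E₁ →L[ℝ] E₂ →L[ℝ] G) {T : ℝ}
    {f : ℝ → E₁} {g : ℝ → E₂} (hf : IntegrableOn f (Ioo 0 T)) (hg : IntegrableOn g (Ioo 0 T)) :
    ∫ t in Ioo 0 T, L (f t) (∫ s in Ioo 0 t, g s)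
      = ∫ s in Ioo 0 T, L (∫ t in Ioo s T, f t) (g s) := by
  set μ := volume.restrict (Ioo (0 : ℝ) T)
  have hm : MeasurableSet {p : ℝ × ℝ | p.2 < p.1} := measurableSet_lt measurable_snd measurable_fst
  have hi : Integrable (fun p : ℝ × ℝ => L (f p.1) (g p.2)) (μ.prod μ) := by
    exact Integrable.op_fst_snd (op := fun x y => L x y) (by fun_prop) ⟨‖L‖, L.le_opNorm₂⟩ hf hg
  have key := integral_integral_swap
    (f := fun t s => indicator {p : ℝ × ℝ | p.2 < p.1} (fun p => L (f p.1) (g p.2)) (t, s))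
    (hi.indicator hm)
  refine Eq.trans ?_ (key.trans ?_)
  · refine setIntegral_congr_fun measurableSet_Ioo fun t ht => ?_
    have h1 : (fun s => indicator {p : ℝ × ℝ | p.2 < p.1} (fun p => L (f p.1) (g p.2)) (t, s))
        = indicator (Iio t) (fun s => L (f t) (g s)) := by
      ext s; simp [indicator]
    have h2 : Ioo 0 T ∩ Iio t = Ioo 0 t := by
      ext s; simp only [mem_inter_iff, mem_Ioo, mem_Iio]
      constructor
      · rintro ⟨⟨h, -⟩, h'⟩; exact ⟨h, h'⟩
      · rintro ⟨h, h'⟩; exact ⟨⟨h, h'.trans ht.2⟩, h'⟩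
    simp only [h1]
    rw [setIntegral_indicator measurableSet_Iio, h2, ContinuousLinearMap.integral_comp_comm]
    exact hg.mono_set (Ioo_subset_Ioo_right ht.2.le)
  · refine setIntegral_congr_fun measurableSet_Ioo fun s hs => ?_
    have h1 : (fun t => indicator {p : ℝ × ℝ | p.2 < p.1} (fun p => L (f p.1) (g p.2)) (t, s))
        = indicator (Ioi s) (fun t => L (f t) (g s)) := by
      ext t; simp [indicator]
    have h2 : Ioo 0 T ∩ Ioi s = Ioo s T := by
      ext t; simp only [mem_inter_iff, mem_Ioo, mem_Ioi]
      constructor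
      · rintro ⟨⟨-, h⟩, h'⟩; exact ⟨h', h⟩
      · rintro ⟨h, h'⟩; exact ⟨⟨hs.1.trans h, h'⟩, h⟩
    simp only [h1]
    rw [setIntegral_indicator measurableSet_Ioi, h2]
    exact ((L.flip (g s)).integral_comp_comm (hf.mono_set (Ioo_subset_Ioo_left hs.1.le)))

theorem continuousOn_primitive_Ioo {E₁ : Type*} [NormedAddCommGroup E₁] [NormedSpace ℝ E₁]
    {T : ℝ} {g : ℝ → E₁} (hg : IntegrableOn g (Ioo 0 T)) :
    ContinuousOn (fun t => ∫ s in Ioo 0 t, g s) (Icc 0 T) := by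
  simpa only [integral_Ioc_eq_integral_Ioo] using
    intervalIntegral.continuousOn_primitive ((integrableOn_Icc_iff_integrableOn_Ioo).2 hg)

theorem setIntegral_Ioo_sub {E₁ : Type*} [NormedAddCommGroup E₁] [NormedSpace ℝ E₁]
    {s t : ℝ} {g : ℝ → E₁} (hs : 0 ≤ s) (hst : s ≤ t) (hg : IntegrableOn g (Ioo 0 t)) :
    ∫ τ in Ioo s t, g τ = (∫ τ in Ioo 0 t, g τ) - ∫ τ in Ioo 0 s, g τ := by
  have h : IntegrableOn g (Ioc 0 t) := (integrableOn_Ioc_iff_integrableOn_Ioo).2 hg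
  simp only [← integral_Ioc_eq_integral_Ioo]
  rw [eq_sub_iff_add_eq', ← setIntegral_union (Ioc_disjoint_Ioc_of_le le_rfl) measurableSet_Ioc
    (h.mono_set (Ioc_subset_Ioc_right hst)) (h.mono_set (Ioc_subset_Ioc_left hs)),
    Ioc_union_Ioc_eq_Ioc hs hst]

theorem IsTest.integrableOn {η : ℝ → ℝ} {U : Set ℝ} (h : IsTest U η) (s : Set ℝ) :
    IntegrableOn η s :=
  (h.smooth.continuous.integrable_of_hasCompactSupport h.compact).integrableOn

theorem IsTest.deriv {η : ℝ → ℝ} {U : Set ℝ} (h : IsTest U η) : IsTest U (deriv η) :=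
  ⟨(contDiff_infty_iff_deriv.1 h.smooth).2, h.compact.deriv,
    (closure_minimal (support_deriv_subset) (isClosed_tsupport η)).trans h.supp⟩

theorem IsTest.eq_zero {η : ℝ → ℝ} {U : Set ℝ} (h : IsTest U η) {t : ℝ} (ht : t ∉ U) :
    η t = 0 := image_eq_zero_of_notMem_tsupport fun h' => ht (h.supp h')

/-- A test function on `(0,T)` with vanishing mean is the derivative of a test function. -/
theorem IsTest.exists_deriv_eq {T : ℝ} {ψ : ℝ → ℝ} (h : IsTest (Ioo 0 T) ψ)
    (h0 : ∫ t in Ioo 0 T, ψ t = 0) :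
    ∃ θ : ℝ → ℝ, IsTest (Ioo 0 T) θ ∧ ∀ t, _root_.deriv θ t = ψ t := by
  rcases (tsupport ψ).eq_empty_or_nonempty with he | hne
  · refine ⟨0, ⟨contDiff_const, HasCompactSupport.zero, by simp [tsupport]⟩, fun t => ?_⟩
    rw [tsupport_eq_empty_iff.1 he]; simp
  obtain ⟨a, ha⟩ := h.compact.isCompact.exists_isLeast hne
  obtain ⟨b, hb⟩ := h.compact.isCompact.exists_isGreatest hne
  have hab : tsupport ψ ⊆ Icc a b := fun x hx => ⟨ha.2 hx, hb.2 hx⟩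
  have haT := h.supp ha.1
  have hbT := h.supp hb.1
  have hz : ∀ t, t ∉ Icc a b → ψ t = 0 := fun t ht =>
    image_eq_zero_of_notMem_tsupport fun h' => ht (hab h')
  have hi : ∀ x y : ℝ, IntervalIntegrable ψ volume x y := fun x y =>
    h.smooth.continuous.intervalIntegrable x y
  set θ : ℝ → ℝ := fun t => ∫ s in a..t, ψ s
  have hd : ∀ t, HasDerivAt θ (ψ t) t := fun t =>
    intervalIntegral.integral_hasDerivAt_right (hi a t)
      (h.smooth.continuous.stronglyMeasurableAtFilter _ _) h.smooth.continuous.continuousAt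
  have hd' : _root_.deriv θ = ψ := funext fun t => (hd t).deriv
  have hθ : ∀ t, t ∉ Icc a b → θ t = 0 := by
    intro t ht
    rcases not_and_or.1 ht with h1 | h1
    · refine intervalIntegral.integral_zero_ae (ae_of_all _ fun s hs => ?_)
      rw [uIoc_of_ge (not_le.1 h1).le] at hs
      rcases hs.2.lt_or_eq with h2 | rfl
      · exact hz s fun h' => absurd h'.1 (not_le.2 h2)
      · -- the left end point: `ψ` vanishes to its left, hence also there
        have : Filter.Tendsto ψ (nhdsWithin s (Iio s)) (nhds (ψ s)) :=
          h.smooth.continuous.continuousAt.mono_left nhdsWithin_le_nhds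
        refine tendsto_nhds_unique this (tendsto_const_nhds.congr' ?_)
        filter_upwards [self_mem_nhdsWithin] with x hx
        exact (hz x fun h' => absurd h'.1 (not_le.2 hx)).symm
    · have h2 : ∫ s in a..t, ψ s = ∫ s in Ioo 0 T, ψ s := by
        rw [intervalIntegral.integral_of_le ((hb.2 ha.1).trans (not_le.1 h1).le),
          ← integral_Icc_eq_integral_Ioc]
        rw [setIntegral_eq_integral_of_forall_compl_eq_zero,
          setIntegral_eq_integral_of_forall_compl_eq_zero]
        · intro x hx; exact h.eq_zero hx
        · intro x hx
          exact hz x fun h' => hx ⟨h'.1, h'.2.trans (not_le.1 h1).le⟩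
      exact h2.trans h0
  refine ⟨θ, ⟨?_, ?_, ?_⟩, fun t => (hd t).deriv⟩
  · rw [contDiff_infty_iff_deriv, hd']
    exact ⟨fun t => (hd t).differentiableAt, h.smooth⟩
  · exact HasCompactSupport.intro isCompact_Icc hθ
  · refine (closure_minimal (fun x hx => ?_) isClosed_Icc).trans (Icc_subset_Ioo haT.1 hbT.2)
    by_contra h'
    exact hx (hθ x h')

theorem exists_isTest_integral_eq_one {T : ℝ} (hT : 0 < T) :
    ∃ η : ℝ → ℝ, IsTest (Ioo 0 T) η ∧ ∫ t in Ioo 0 T, η t = 1 := by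
  let b : ContDiffBump (T / 2) := ⟨T / 8, T / 4, by positivity, by linarith⟩
  have ht : tsupport (b.normed volume) ⊆ Ioo 0 T := by
    rw [b.tsupport_normed_eq, Real.closedBall_eq_Icc]
    intro x hx
    have h1 : b.rOut = T / 4 := rfl
    rw [h1] at hx
    constructor <;> linarith [hx.1, hx.2]
  have h : IsTest (Ioo 0 T) (b.normed volume) :=
    ⟨b.contDiff_normed, b.hasCompactSupport_normed, ht⟩
  refine ⟨_, h, ?_⟩
  rw [setIntegral_eq_integral_of_forall_compl_eq_zero fun x hx => h.eq_zero hx]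
  exact b.integral_normed

theorem IsTest.sub_const_mul {V : Type*} [NormedAddCommGroup V] [NormedSpace ℝ V] {U : Set V}
    {φ ψ : V → ℝ} (hφ : IsTest U φ) (hψ : IsTest U ψ) (c : ℝ) :
    IsTest U (fun x => φ x - c * ψ x) := by
  have h1 : tsupport (fun x => c * ψ x) ⊆ tsupport ψ := tsupport_smul_subset_right (fun _ => c) ψ
  exact ⟨hφ.smooth.sub (contDiff_const.mul hψ.smooth), hφ.compact.sub hψ.compact.mul_left,
    (tsupport_sub _ _).trans (union_subset hφ.supp (h1.trans hψ.supp))⟩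

theorem IsTest.integrable_smul {V : Type*} [NormedAddCommGroup V] [NormedSpace ℝ V] {T : ℝ}
    {η : ℝ → ℝ} {f : ℝ → V} {U : Set ℝ} (h : IsTest U η) (hf : IntegrableOn f (Ioo 0 T)) :
    IntegrableOn (fun t => η t • f t) (Ioo 0 T) := by
  obtain ⟨C, hC⟩ := h.compact.exists_bound_of_continuous h.smooth.continuous
  exact hf.bdd_smul C h.smooth.continuous.aestronglyMeasurable (ae_of_all _ hC)

/-- The du Bois-Reymond lemma. -/
theorem ae_eq_const_of_integral_deriv_smul_eq_zero {V : Type*} [NormedAddCommGroup V]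
    [NormedSpace ℝ V] [CompleteSpace V] {T : ℝ} (hT : 0 < T) {f : ℝ → V}
    (hf : IntegrableOn f (Ioo 0 T))
    (h : ∀ η : ℝ → ℝ, IsTest (Ioo 0 T) η → ∫ t in Ioo 0 T, deriv η t • f t = 0) :
    ∃ c : V, ∀ᵐ t ∂(volume.restrict (Ioo 0 T)), f t = c := by
  obtain ⟨η₀, hη₀, h1⟩ := exists_isTest_integral_eq_one hT
  refine ⟨∫ t in Ioo 0 T, η₀ t • f t, ?_⟩
  set c := ∫ t in Ioo 0 T, η₀ t • f t
  have hfc : IntegrableOn (fun t => f t - c) (Ioo 0 T) := hf.sub (by simp)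
  have key := isOpen_Ioo.ae_eq_zero_of_integral_contDiff_smul_eq_zero (μ := volume)
    (U := Ioo 0 T) (f := fun t => f t - c) hfc.locallyIntegrableOn ?_
  · rw [ae_restrict_iff' measurableSet_Ioo]
    filter_upwards [key] with t ht h'
    exact sub_eq_zero.1 (ht h')
  intro ψ hψ1 hψ2 hψ3
  have hψ : IsTest (Ioo 0 T) ψ := ⟨hψ1, hψ2, hψ3⟩
  set m := ∫ t in Ioo 0 T, ψ t
  obtain ⟨θ, hθ, hθ'⟩ := (hψ.sub_const_mul hη₀ m).exists_deriv_eq (by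
    rw [integral_sub (hψ.integrableOn _) ((hη₀.integrableOn _).const_mul _), integral_const_mul, h1]
    simp [m])
  have h2 : ∫ t in Ioo 0 T, ψ t • f t = m • c := by
    have := h θ hθ
    simp only [hθ', sub_smul, mul_smul] at this
    rw [integral_sub (hψ.integrable_smul hf) (by exact (hη₀.integrable_smul hf).smul m),
      integral_smul, sub_eq_zero] at this
    exact this
  rw [← setIntegral_eq_integral_of_forall_compl_eq_zero (s := Ioo 0 T) fun x hx => by
    simp [hψ.eq_zero hx]]
  simp only [smul_sub]
  rw [integral_sub (hψ.integrable_smul hf) ((hψ.integrableOn _).smul_const c), h2,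
    integral_smul_const, sub_self]

/-- A function with an integrable weak derivative is almost everywhere a primitive of it. -/
theorem ae_eq_add_primitive {V : Type*} [NormedAddCommGroup V]
    [NormedSpace ℝ V] [CompleteSpace V] {T : ℝ} (hT : 0 < T) {f g : ℝ → V}
    (hf : IntegrableOn f (Ioo 0 T)) (hg : IntegrableOn g (Ioo 0 T))
    (h : ∀ η : ℝ → ℝ, IsTest (Ioo 0 T) η →
      ∫ t in Ioo 0 T, deriv η t • f t = -∫ t in Ioo 0 T, η t • g t) :
    ∃ a : V, ∀ᵐ t ∂(volume.restrict (Ioo 0 T)), f t = a + ∫ s in Ioo 0 t, g s := by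
  have hP : IntegrableOn (fun t => ∫ s in Ioo 0 t, g s) (Ioo 0 T) :=
    ((continuousOn_primitive_Ioo hg).integrableOn_Icc).mono_set Ioo_subset_Icc_self
  obtain ⟨a, ha⟩ := ae_eq_const_of_integral_deriv_smul_eq_zero hT (hf.sub hP) fun η hη => by
    simp only [Pi.sub_apply, smul_sub]
    rw [integral_sub (hη.deriv.integrable_smul hf) (hη.deriv.integrable_smul hP), h η hη]
    have := integral_primitive_swap (ContinuousLinearMap.lsmul ℝ ℝ (E := V))
      (hη.deriv.integrableOn (Ioo 0 T)) hg
    simp only [ContinuousLinearMap.lsmul_apply] at this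
    rw [this, ← integral_neg, sub_eq_zero]
    refine setIntegral_congr_fun measurableSet_Ioo fun s hs => ?_
    have h2 : ∫ t in Ioo s T, deriv η t = η T - η s := by
      rw [← integral_Ioc_eq_integral_Ioo, ← intervalIntegral.integral_of_le hs.2.le]
      exact intervalIntegral.integral_deriv_eq_sub
        (fun x _ => (hη.smooth.differentiable (by simp)).differentiableAt)
        (hη.deriv.smooth.continuous.intervalIntegrable _ _)
    simp only [h2, hη.eq_zero (t := T) (by simp), zero_sub, neg_smul]
  refine ⟨a, ?_⟩
  filter_upwards [ha] with t ht
  rw [← ht]; simp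

/-- The fundamental theorem of calculus for `‖u‖²`, where `u(t) = a + ∫₀ᵗ g` with `g` merely
integrable. -/
theorem norm_sq_add_primitive {H : Type*} [NormedAddCommGroup H] [InnerProductSpace ℝ H]
    [CompleteSpace H] {t : ℝ} {g : ℝ → H} (hg : IntegrableOn g (Ioo 0 t)) (a : H) :
    ‖a + ∫ s in Ioo 0 t, g s‖ ^ 2
      = ‖a‖ ^ 2 + 2 * ∫ s in Ioo 0 t, inner ℝ (g s) (a + ∫ r in Ioo 0 s, g r) := by
  set G := ∫ s in Ioo 0 t, g s
  have h1 : ∫ s in Ioo 0 t, inner ℝ (g s) (∫ r in Ioo 0 s, g r)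
      = ∫ s in Ioo 0 t, inner ℝ (∫ τ in Ioo s t, g τ) (g s) :=
    integral_primitive_swap (innerSL ℝ (E := H)) hg hg
  have hc : ∀ x : H, ∫ s in Ioo 0 t, inner ℝ (g s) x = inner ℝ G x := fun x => by
    have := (innerSL ℝ x).integral_comp_comm hg
    simp only [innerSL_apply_apply] at this
    simp only [real_inner_comm x, this, G]
  have hci : ∀ x : H, IntegrableOn (fun s => (inner ℝ (g s) x : ℝ)) (Ioo 0 t) := fun x =>
    Integrable.inner_const hg x
  obtain ⟨C, hC⟩ := isCompact_Icc.exists_bound_of_continuousOn (continuousOn_primitive_Ioo hg)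
  have hgi : IntegrableOn (fun s => (inner ℝ (g s) (∫ r in Ioo 0 s, g r) : ℝ)) (Ioo 0 t) := by
    refine Integrable.mono' (hg.norm.mul_const C)
      (hg.aestronglyMeasurable.inner (((continuousOn_primitive_Ioo hg).mono
        Ioo_subset_Icc_self).aestronglyMeasurable measurableSet_Ioo)) ?_
    rw [ae_restrict_iff' measurableSet_Ioo]
    refine ae_of_all _ fun s hs => (norm_inner_le_norm _ _).trans ?_
    exact mul_le_mul_of_nonneg_left (hC s (Ioo_subset_Icc_self hs)) (norm_nonneg _)
  have h2 : ∫ s in Ioo 0 t, inner ℝ (∫ τ in Ioo s t, g τ) (g s)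
      = inner ℝ G G - ∫ s in Ioo 0 t, inner ℝ (g s) (∫ r in Ioo 0 s, g r) := by
    rw [← hc, ← integral_sub (hci _) hgi]
    refine setIntegral_congr_fun measurableSet_Ioo fun s hs => ?_
    rw [setIntegral_Ioo_sub hs.1.le hs.2.le hg, real_inner_comm, inner_sub_right]
  simp only [inner_add_right]
  rw [integral_add (hci a) hgi, hc, norm_add_sq_real, real_inner_comm a G,
    ← real_inner_self_eq_norm_sq G]
  linarith [h1.trans h2]

/-! ### Continuous representatives in an abstract Gelfand triple -/

section Gelfand

open Filter Topology

theorem integrable_inner_of_memLp {V : Type*} [NormedAddCommGroup V] [InnerProductSpace ℝ V]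
    {α : Type*} [MeasurableSpace α] {μ : Measure α} {f g : α → V}
    (hf : MemLp f 2 μ) (hg : MemLp g 2 μ) : Integrable (fun t => (inner ℝ (f t) (g t) : ℝ)) μ := by
  refine Integrable.mono' (hf.norm.integrable_mul hg.norm) (hf.1.inner hg.1)
    (ae_of_all _ fun t => ?_)
  exact norm_inner_le_norm _ _

/-- Strong convergence of uniformly bounded operators yields convergence in `L²(0,T;V)`. -/
theorem tendsto_integral_norm_sub_sq {V : Type*} [NormedAddCommGroup V]
    [NormedSpace ℝ V] {S : ℕ → V →L[ℝ] V} (hS : ∀ n x, ‖S n x‖ ≤ ‖x‖)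
    (hlim : ∀ x, Tendsto (fun n => S n x) atTop (𝓝 x)) {T : ℝ} {f : ℝ → V}
    (hf : MemLp f 2 (volume.restrict (Ioo 0 T))) :
    Tendsto (fun n => ∫ t in Ioo 0 T, ‖S n (f t) - f t‖ ^ 2) atTop (𝓝 0) := by
  suffices h : Tendsto (fun n => ∫ t in Ioo 0 T, ‖S n (f t) - f t‖ ^ 2) atTop
      (𝓝 (∫ t in Ioo 0 T, (0 : ℝ))) by simpa using h
  refine tendsto_integral_of_dominated_convergence (fun t => (2 * ‖f t‖) ^ 2)
    (fun n => ?_) ?_ (fun n => ae_of_all _ fun t => ?_) (ae_of_all _ fun t => ?_)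
  · have h : MemLp (fun t => S n (f t) - f t) 2 (volume.restrict (Ioo 0 T)) :=
      MemLp.sub ((S n).comp_memLp' hf) hf
    exact h.1.norm.pow 2
  · simp only [mul_pow]
    exact (hf.integrable_norm_pow (by norm_num)).const_mul _
  · rw [Real.norm_of_nonneg (by positivity)]
    gcongr
    calc _ ≤ ‖S n (f t)‖ + ‖f t‖ := norm_sub_le _ _
      _ ≤ _ := by linarith [hS n (f t)]
  · have h := ((hlim (f t)).sub_const (f t)).norm.pow 2
    simpa using h

variable {V H : Type*} [NormedAddCommGroup V] [InnerProductSpace ℝ V] [CompleteSpace V]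
  [NormedAddCommGroup H] [InnerProductSpace ℝ H] [CompleteSpace H]

/-- For `K` symmetric, nonnegative and injective, the resolvents `Rₙ = (K + 1/(n+1))⁻¹` are
approximate inverses of `K`: the contractions `K Rₙ` converge strongly to the identity. -/
theorem exists_approx_inverse (K : V →L[ℝ] V) (hs : ∀ x y, inner ℝ (K x) y = inner ℝ x (K y))
    (hp : ∀ x, 0 ≤ inner ℝ (K x) x) (hi : Function.Injective K) :
    ∃ R : ℕ → V →L[ℝ] V, (∀ n x, R n (K x) = K (R n x)) ∧ (∀ n x, ‖K (R n x)‖ ≤ ‖x‖) ∧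
      ∀ x, Tendsto (fun n => K (R n x)) atTop (𝓝 x) := by
  have hex : ∀ ε : ℝ, 0 < ε → ∃ e : V ≃L[ℝ] V, ∀ x, e x = K x + ε • x := by
    intro ε hε
    let B : V →L[ℝ] V →L[ℝ] ℝ := (innerSL ℝ (E := V)).comp (K + ε • ContinuousLinearMap.id ℝ V)
    have hB : ∀ x y, B x y = inner ℝ (K x + ε • x) y := fun x y => rfl
    have hco : IsCoercive B := by
      refine ⟨ε, hε, fun x => ?_⟩
      rw [hB, inner_add_left, real_inner_smul_left, real_inner_self_eq_norm_sq]
      nlinarith [hp x]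
    refine ⟨hco.continuousLinearEquivOfBilin, fun x => ext_inner_right ℝ fun y => ?_⟩
    rw [hco.continuousLinearEquivOfBilin_apply, hB]
  choose! e he using hex
  let ε : ℕ → ℝ := fun n => 1 / ((n : ℝ) + 1)
  have hε : ∀ n, 0 < ε n := fun n => by positivity
  have hε0 : Tendsto ε atTop (𝓝 0) := tendsto_one_div_add_atTop_nhds_zero_nat
  -- the resolvent commutes with `K` because `K + ε` does
  have hcomm : ∀ n x, (e (ε n)).symm (K x) = K ((e (ε n)).symm x) := by
    intro n x
    rw [ContinuousLinearEquiv.symm_apply_eq, he _ (hε n), ← map_smul, ← map_add, ← he _ (hε n),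
      ContinuousLinearEquiv.apply_symm_apply]
  have hres : ∀ n x, x - K ((e (ε n)).symm x) = ε n • (e (ε n)).symm x := by
    intro n x
    rw [sub_eq_iff_eq_add', ← he _ (hε n), ContinuousLinearEquiv.apply_symm_apply]
  -- with `r = (K + ε)⁻¹ x`, monotonicity of `K` gives `⟨K r, x - K r⟩ = ε ⟨K r, r⟩ ≥ 0`
  have hcontr : ∀ n x, ‖K ((e (ε n)).symm x)‖ ≤ ‖x‖ := by
    intro n x
    set r := (e (ε n)).symm x
    have h1 : 0 ≤ inner ℝ (K r) (x - K r) := by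
      rw [hres, real_inner_smul_right]
      exact mul_nonneg (hε n).le (hp r)
    rw [inner_sub_right, real_inner_self_eq_norm_sq] at h1
    have h2 := real_inner_le_norm (K r) x
    by_contra! h3
    nlinarith [norm_nonneg x, norm_nonneg (K r)]
  -- a symmetric injective operator has dense range, and on the range convergence is explicit
  have hdense : DenseRange K := by
    have h0 : (K : V →ₗ[ℝ] V).range.topologicalClosure = ⊤ := by
      rw [Submodule.topologicalClosure_eq_top_iff, Submodule.eq_bot_iff]
      intro x hx
      refine hi (?_ : K x = K 0)
      rw [map_zero, ← inner_self_eq_zero (𝕜 := ℝ), hs]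
      rw [real_inner_comm]
      exact (Submodule.mem_orthogonal _ x).1 hx _ ⟨K x, rfl⟩
    intro x
    have : x ∈ (K : V →ₗ[ℝ] V).range.topologicalClosure := by rw [h0]; trivial
    exact this
  refine ⟨fun n => (e (ε n)).symm, hcomm, hcontr, fun x => ?_⟩
  rw [Metric.tendsto_atTop]
  intro δ hδ
  obtain ⟨z, hz⟩ := hdense.exists_dist_lt x (ε := δ / 3) (by positivity)
  have hev : ∀ᶠ n in atTop, ε n * ‖z‖ < δ / 3 := by
    have : Tendsto (fun n => ε n * ‖z‖) atTop (𝓝 (0 * ‖z‖)) := hε0.mul_const _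
    rw [zero_mul] at this
    exact this.eventually_lt_const (by positivity)
  obtain ⟨N, hN⟩ := eventually_atTop.1 hev
  refine ⟨N, fun n hn => ?_⟩
  have h1 : ‖K ((e (ε n)).symm (K z)) - K z‖ ≤ ε n * ‖z‖ := by
    rw [norm_sub_rev, hres, hcomm, norm_smul, Real.norm_of_nonneg (hε n).le]
    exact mul_le_mul_of_nonneg_left (hcontr n z) (hε n).le
  have h2 : K ((e (ε n)).symm x) - x = K ((e (ε n)).symm (x - K z))
      + (K ((e (ε n)).symm (K z)) - K z) - (x - K z) := by
    simp only [map_sub]; abel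
  rw [dist_eq_norm] at hz
  have h3 := hcontr n (x - K z)
  have h4 := hN n hn
  change dist (K ((e (ε n)).symm x)) x < δ
  rw [dist_eq_norm, h2]
  calc _ ≤ ‖K ((e (ε n)).symm (x - K z))‖ + ‖K ((e (ε n)).symm (K z)) - K z‖ + ‖x - K z‖ :=
        (norm_sub_le _ _).trans (add_le_add_left (norm_add_le _ _) _)
    _ < δ := by linarith


/-- The energy identity for the regularization `R (a + ∫₀ᵗ W)` of `u`, where `R` commutes with
`K = J†J` and `K u = a + ∫₀ᵗ W`. -/
theorem regularized_energy {J : V →L[ℝ] H} {K : V →L[ℝ] V}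
    (hK : ∀ x y, inner ℝ (K x) y = inner ℝ (J x) (J y)) {T : ℝ} {u W : ℝ → V}
    (hW : IntegrableOn W (Ioo 0 T)) {a : V}
    (hP : ∀ᵐ t ∂(volume.restrict (Ioo 0 T)), K (u t) = a + ∫ s in Ioo 0 t, W s)
    {R : V →L[ℝ] V} (hR : ∀ x, R (K x) = K (R x)) {t : ℝ} (ht : t ∈ Icc 0 T) :
    ‖J (R (a + ∫ s in Ioo 0 t, W s))‖ ^ 2
      = ‖J (R a)‖ ^ 2 + 2 * ∫ s in Ioo 0 t, inner ℝ (K (R (W s))) (K (R (u s))) := by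
  have hWt : ∀ t ∈ Icc 0 T, IntegrableOn W (Ioo 0 t) := fun t ht =>
    hW.mono_set (Ioo_subset_Ioo_right ht.2)
  have h1 : ∀ t ∈ Icc 0 T, J (R (a + ∫ s in Ioo 0 t, W s))
      = J (R a) + ∫ s in Ioo 0 t, J (R (W s)) := by
    intro t ht
    have := (J.comp R).integral_comp_comm (hWt t ht)
    simp only [ContinuousLinearMap.comp_apply] at this
    rw [this, map_add, map_add]
  rw [h1 t ht, norm_sq_add_primitive (g := fun s => J (R (W s)))
    ((J.comp R).integrable_comp (hWt t ht))]
  congr 2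
  refine integral_congr_ae ?_
  have h2 := ae_restrict_of_ae_restrict_of_subset (Ioo_subset_Ioo_right ht.2 : Ioo 0 t ⊆ _) hP
  filter_upwards [h2, ae_restrict_mem measurableSet_Ioo] with s hs hs'
  rw [← h1 s ⟨hs'.1.le, hs'.2.le.trans ht.2⟩, ← hs, ← hK, hR]

/-- The uniform bound in time on the regularization of `u` by its norm in
`L²(0,T;V) ∩ H¹(0,T;V')`. -/
theorem regularized_sup_bound {J : V →L[ℝ] H} {K : V →L[ℝ] V}
    (hK : ∀ x y, inner ℝ (K x) y = inner ℝ (J x) (J y)) {T : ℝ} (hT : 0 < T) {u W : ℝ → V}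
    (hu : MemLp u 2 (volume.restrict (Ioo 0 T))) (hW : MemLp W 2 (volume.restrict (Ioo 0 T)))
    {a : V} (hP : ∀ᵐ t ∂(volume.restrict (Ioo 0 T)), K (u t) = a + ∫ s in Ioo 0 t, W s)
    {R : V →L[ℝ] V} (hR : ∀ x, R (K x) = K (R x)) {t : ℝ} (ht : t ∈ Icc 0 T) :
    ‖J (R (a + ∫ s in Ioo 0 t, W s))‖ ^ 2
      ≤ (‖J‖ ^ 2 / T + 2) * ∫ s in Ioo 0 T, (‖K (R (W s))‖ ^ 2 + ‖K (R (u s))‖ ^ 2) := by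
  have hWi : IntegrableOn W (Ioo 0 T) := hW.integrable (by norm_num)
  set κ := ∫ s in Ioo 0 T, (‖K (R (W s))‖ ^ 2 + ‖K (R (u s))‖ ^ 2)
  have hKW : MemLp (fun s => K (R (W s))) 2 (volume.restrict (Ioo 0 T)) :=
    (K.comp R).comp_memLp' hW
  have hKu : MemLp (fun s => K (R (u s))) 2 (volume.restrict (Ioo 0 T)) :=
    (K.comp R).comp_memLp' hu
  have hki : IntegrableOn (fun s => ‖K (R (W s))‖ ^ 2 + ‖K (R (u s))‖ ^ 2) (Ioo 0 T) :=
    (hKW.integrable_norm_pow (by norm_num)).add (hKu.integrable_norm_pow (by norm_num))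
  have hpt : ∀ s ∈ Icc 0 T,
      |∫ r in Ioo 0 s, inner ℝ (K (R (W r))) (K (R (u r)))| ≤ κ / 2 := by
    intro s hs
    rw [← Real.norm_eq_abs]
    refine (norm_integral_le_integral_norm _).trans ?_
    have h1 : ∫ r in Ioo 0 s, ‖(inner ℝ (K (R (W r))) (K (R (u r))) : ℝ)‖
        ≤ ∫ r in Ioo 0 T, ‖(inner ℝ (K (R (W r))) (K (R (u r))) : ℝ)‖ :=
      setIntegral_mono_set (integrable_inner_of_memLp hKW hKu).norm
        (ae_of_all _ fun _ => norm_nonneg _) (Ioo_subset_Ioo_right hs.2).eventuallyLE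
    refine h1.trans ?_
    rw [← integral_div]
    refine integral_mono (integrable_inner_of_memLp hKW hKu).norm (hki.div_const 2) fun r => ?_
    have h2 := norm_inner_le_norm (𝕜 := ℝ) (K (R (W r))) (K (R (u r)))
    simp only
    nlinarith [sq_nonneg (‖K (R (W r))‖ - ‖K (R (u r))‖)]
  set c : ℝ → H := fun t => J (R (a + ∫ s in Ioo 0 t, W s))
  -- compare the value at `t` with those at all `s`, and average over `s ∈ (0,T)`
  have hcmp : ∀ s ∈ Ioo 0 T, ‖c t‖ ^ 2 - 2 * κ ≤ ‖c s‖ ^ 2 := by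
    intro s hs
    have hs' := Ioo_subset_Icc_self hs
    simp only [c]
    rw [regularized_energy hK hWi hP hR ht, regularized_energy hK hWi hP hR hs']
    linarith [abs_le.1 (hpt t ht), abs_le.1 (hpt s hs')]
  have hcs : ∀ᵐ s ∂(volume.restrict (Ioo 0 T)),
      ‖c t‖ ^ 2 - 2 * κ ≤ ‖J‖ ^ 2 * (‖K (R (W s))‖ ^ 2 + ‖K (R (u s))‖ ^ 2) := by
    filter_upwards [hP, ae_restrict_mem measurableSet_Ioo] with s hs hs'
    refine (hcmp s hs').trans ?_
    simp only [c]
    rw [← hs, hR]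
    have h3 := J.le_opNorm (K (R (u s)))
    calc _ ≤ (‖J‖ * ‖K (R (u s))‖) ^ 2 := by gcongr
      _ ≤ _ := by rw [mul_pow]; gcongr; nlinarith [sq_nonneg ‖K (R (W s))‖]
  have h4 := integral_mono_ae (by simp) (hki.const_mul _) hcs
  rw [integral_const_mul] at h4
  simp only [integral_const, MeasurableSet.univ, measureReal_restrict_apply, univ_inter,
    Real.volume_real_Ioo_of_le hT.le, sub_zero, smul_eq_mul] at h4
  have h5 : ‖c t‖ ^ 2 ≤ ‖J‖ ^ 2 * κ / T + 2 * κ := by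
    rw [← sub_le_iff_le_add, le_div_iff₀ hT]
    linarith
  calc _ ≤ _ := h5
    _ = _ := by ring

/-- The Lions–Magenes lemma: if `u ∈ L²(0,T;V)` has the weak derivative `w ∈ L²(0,T;V')`, then `u`
has a representative in `C([0,T];H)`, for which the energy identity holds. Regularization by the
resolvents of `J†J` makes `u` absolutely continuous with values in `V`, and commutes with the time
derivative, so that no smoothing in time is needed. -/
theorem exists_continuousOn_rep (J : V →L[ℝ] H) (hJ : Function.Injective J)
    (F : V →L[ℝ] StrongDual ℝ V) (hF : ∀ x y, F x y = inner ℝ (J x) (J y))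
    {T : ℝ} (hT : 0 < T) {u : ℝ → V} {w : ℝ → StrongDual ℝ V}
    (hu : MemLp u 2 (volume.restrict (Ioo 0 T))) (hw : MemLp w 2 (volume.restrict (Ioo 0 T)))
    (h : ∀ η : ℝ → ℝ, IsTest (Ioo 0 T) η →
      ∫ t in Ioo 0 T, deriv η t • F (u t) = -∫ t in Ioo 0 T, η t • w t) :
    ∃ c : ℝ → H, ContinuousOn c (Icc 0 T) ∧
      (∀ᵐ t ∂(volume.restrict (Ioo 0 T)), c t = J (u t)) ∧
      ‖c T‖ ^ 2 = ‖c 0‖ ^ 2 + 2 * ∫ t in Ioo 0 T, w t (u t) := by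
  let ι : StrongDual ℝ V →L[ℝ] V :=
    ((InnerProductSpace.toDual ℝ V).symm.toContinuousLinearEquiv : StrongDual ℝ V →L⋆[ℝ] V)
  have hι : ∀ Φ x, inner ℝ (ι Φ) x = Φ x := fun Φ x =>
    InnerProductSpace.toDual_symm_apply (𝕜 := ℝ) (E := V)
  let K : V →L[ℝ] V := ι.comp F
  have hK : ∀ x y, inner ℝ (K x) y = inner ℝ (J x) (J y) := fun x y => by
    rw [← hF]; exact hι _ _
  let W : ℝ → V := fun t => ι (w t)
  have hW : MemLp W 2 (volume.restrict (Ioo 0 T)) := ι.comp_memLp' hw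
  have hui : IntegrableOn u (Ioo 0 T) := hu.integrable (by norm_num)
  have hwi : IntegrableOn w (Ioo 0 T) := hw.integrable (by norm_num)
  obtain ⟨b, hb⟩ := ae_eq_add_primitive hT (F.integrable_comp hui) hwi h
  have hP : ∀ᵐ t ∂(volume.restrict (Ioo 0 T)), K (u t) = ι b + ∫ s in Ioo 0 t, W s := by
    filter_upwards [hb, ae_restrict_mem measurableSet_Ioo] with t ht ht'
    change ι (F (u t)) = _
    rw [ht, map_add, ι.integral_comp_comm (hwi.mono_set (Ioo_subset_Ioo_right ht'.2.le))]
  have hWi : IntegrableOn W (Ioo 0 T) := hW.integrable (by norm_num)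
  have hKi : Function.Injective K := by
    rw [injective_iff_map_eq_zero]
    intro x hx
    refine (map_eq_zero_iff J hJ).1 ?_
    rw [← inner_self_eq_zero (𝕜 := ℝ), ← hK, hx, inner_zero_left]
  obtain ⟨R, hR, hRn, hRl⟩ := exists_approx_inverse K
    (fun x y => by rw [hK, real_inner_comm, ← hK, real_inner_comm])
    (fun x => by rw [hK]; exact real_inner_self_nonneg) hKi
  let c : ℕ → ℝ → H := fun n t => J (R n (ι b + ∫ s in Ioo 0 t, W s))
  -- `κ n` is the squared distance of the `n`-th regularization from `u` in the norm of
  -- `L²(0,T;V) ∩ H¹(0,T;V')`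
  let κ : ℕ → ℝ := fun n => (∫ t in Ioo 0 T, ‖K (R n (W t)) - W t‖ ^ 2)
    + ∫ t in Ioo 0 T, ‖K (R n (u t)) - u t‖ ^ 2
  have hκ : Tendsto κ atTop (𝓝 0) := by
    simpa using (tendsto_integral_norm_sub_sq (S := fun n => K.comp (R n)) hRn hRl hW).add
      (tendsto_integral_norm_sub_sq (S := fun n => K.comp (R n)) hRn hRl hu)
  have hdi : ∀ n, ∀ f : ℝ → V, MemLp f 2 (volume.restrict (Ioo 0 T)) →
      IntegrableOn (fun t => ‖K (R n (f t)) - f t‖ ^ 2) (Ioo 0 T) := fun n f hf =>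
    (MemLp.sub ((K.comp (R n)).comp_memLp' hf) hf).integrable_norm_pow (by norm_num)
  have hsq : ∀ x y z : V, ‖x - y‖ ^ 2 ≤ 2 * ‖x - z‖ ^ 2 + 2 * ‖y - z‖ ^ 2 := by
    intro x y z
    have h1 : ‖x - y‖ ≤ ‖x - z‖ + ‖y - z‖ := by
      rw [norm_sub_rev y z]; exact norm_sub_le_norm_sub_add_norm_sub _ _ _
    nlinarith [norm_nonneg (x - y), sq_nonneg (‖x - z‖ - ‖y - z‖)]
  set C := ‖J‖ ^ 2 / T + 2 with hC
  have hC0 : 0 < C := by positivity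
  have hdiff : ∀ n m, ∀ t ∈ Icc 0 T, ‖c n t - c m t‖ ^ 2 ≤ C * (2 * κ n + 2 * κ m) := by
    intro n m t ht
    have h1 := regularized_sup_bound hK hT hu hW hP (R := R n - R m)
      (fun x => by simp [hR]) ht
    simp only [sub_apply, map_sub J, map_sub K] at h1
    refine h1.trans (mul_le_mul_of_nonneg_left ?_ hC0.le)
    have h2 : 2 * κ n + 2 * κ m = ∫ t in Ioo 0 T,
        ((2 * ‖K (R n (W t)) - W t‖ ^ 2 + 2 * ‖K (R m (W t)) - W t‖ ^ 2)
        + (2 * ‖K (R n (u t)) - u t‖ ^ 2 + 2 * ‖K (R m (u t)) - u t‖ ^ 2)) := by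
      rw [integral_add, integral_add, integral_add, integral_const_mul, integral_const_mul,
        integral_const_mul, integral_const_mul]
      · simp only [κ]; ring
      · exact (hdi n u hu).const_mul 2
      · exact (hdi m u hu).const_mul 2
      · exact (hdi n W hW).const_mul 2
      · exact (hdi m W hW).const_mul 2
      · exact ((hdi n W hW).const_mul 2).add ((hdi m W hW).const_mul 2)
      · exact ((hdi n u hu).const_mul 2).add ((hdi m u hu).const_mul 2)
    rw [h2]
    refine integral_mono_of_nonneg (ae_of_all _ fun t => by positivity) ?_
      (ae_of_all _ fun t => add_le_add (hsq _ _ _) (hsq _ _ _))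
    exact (((hdi n W hW).const_mul 2).add ((hdi m W hW).const_mul 2)).add
      (((hdi n u hu).const_mul 2).add ((hdi m u hu).const_mul 2))
  have hcau : UniformCauchySeqOn c atTop (Icc 0 T) := by
    rw [Metric.uniformCauchySeqOn_iff]
    intro ε hε
    have hev : ∀ᶠ n in atTop, κ n < ε ^ 2 / (4 * C) := hκ.eventually_lt_const (by positivity)
    obtain ⟨N, hN⟩ := eventually_atTop.1 hev
    refine ⟨N, fun m hm n hn t ht => ?_⟩
    rw [dist_eq_norm]
    refine lt_of_pow_lt_pow_left₀ 2 hε.le ((hdiff m n t ht).trans_lt ?_)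
    have h1 := hN m hm
    have h2 := hN n hn
    rw [lt_div_iff₀ (by positivity)] at h1 h2
    nlinarith
  have hex : ∀ t ∈ Icc 0 T, ∃ y, Tendsto (fun n => c n t) atTop (𝓝 y) := fun t ht =>
    cauchySeq_tendsto_of_complete (hcau.cauchySeq ht)
  choose! c' hc' using hex
  have hunif : TendstoUniformlyOn c c' atTop (Icc 0 T) :=
    hcau.tendstoUniformlyOn_of_tendsto hc'
  have hRK : ∀ᵐ t ∂(volume.restrict (Ioo 0 T)), ∀ n, c n t = J (K (R n (u t))) := by
    filter_upwards [hP] with t ht n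
    simp only [c]
    rw [← ht, hR]
  refine ⟨c', hunif.continuousOn (Frequently.of_forall fun n => ?_), ?_, ?_⟩
  · exact (J.comp (R n)).continuous.comp_continuousOn
      (continuousOn_const.add (continuousOn_primitive_Ioo hWi))
  · filter_upwards [hRK, ae_restrict_mem measurableSet_Ioo] with t ht ht'
    refine tendsto_nhds_unique (hc' t (Ioo_subset_Icc_self ht')) ?_
    simp only [ht]
    exact (J.continuous.tendsto _).comp (hRl (u t))
  · have hT' : T ∈ Icc 0 T := ⟨hT.le, le_rfl⟩
    have h0' : (0 : ℝ) ∈ Icc 0 T := ⟨le_rfl, hT.le⟩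
    have he : ∀ n, ‖c n T‖ ^ 2 = ‖c n 0‖ ^ 2
        + 2 * ∫ s in Ioo 0 T, inner ℝ (K (R n (W s))) (K (R n (u s))) := by
      intro n
      simp only [c]
      rw [regularized_energy hK hWi hP (hR n) hT']
      simp
    refine tendsto_nhds_unique ((hc' T hT').norm.pow 2) ?_
    simp only [he]
    refine ((hc' 0 h0').norm.pow 2).add (Tendsto.const_mul 2 ?_)
    have hwu : ∀ t, w t (u t) = inner ℝ (W t) (u t) := fun t => (hι _ _).symm
    simp only [hwu]
    refine tendsto_integral_of_dominated_convergence (fun t => ‖W t‖ * ‖u t‖) (fun n => ?_)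
      (hW.norm.integrable_mul hu.norm) (fun n => ae_of_all _ fun t => ?_) (ae_of_all _ fun t => ?_)
    · exact (integrable_inner_of_memLp ((K.comp (R n)).comp_memLp' hW)
        ((K.comp (R n)).comp_memLp' hu)).1
    · refine (norm_inner_le_norm _ _).trans ?_
      exact mul_le_mul (hRn n _) (hRn n _) (norm_nonneg _) (norm_nonneg _)
    · exact (hRl (W t)).inner (hRl (u t))

end Gelfand

/-! ### The space `H¹₀(Ω)` -/

section Space

variable {d : ℕ} {Ω : Set (E d)}

theorem integral_mul_eq_inner (u : L2 Ω) {ψ : E d → ℝ} (hψ : MemLp ψ 2 (volume.restrict Ω)) :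
    ∫ x in Ω, u x * ψ x = inner ℝ (hψ.toLp ψ) u := by
  rw [L2.inner_def]
  refine integral_congr_ae ?_
  filter_upwards [hψ.coeFn_toLp] with x hx
  rw [hx]; rfl

theorem integral_coord_mul_eq_inner (g : L2vec Ω) (i : Fin d) {ψ : E d → ℝ}
    (hψ : MemLp ψ 2 (volume.restrict Ω)) :
    ∫ x in Ω, g x i * ψ x
      = inner ℝ (hψ.toLp ψ) ((EuclideanSpace.proj (𝕜 := ℝ) i : E d →L[ℝ] ℝ).compLp g) := by
  rw [← integral_mul_eq_inner _ hψ]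
  refine integral_congr_ae ?_
  filter_upwards [(EuclideanSpace.proj (𝕜 := ℝ) i : E d →L[ℝ] ℝ).coeFn_compLp g] with x hx
  rw [hx]; rfl

theorem isClosed_H1 (Ω : Set (E d)) : IsClosed (H1 Ω : Set (WithLp 2 (L2 Ω × L2vec Ω))) := by
  have h : (H1 Ω : Set (WithLp 2 (L2 Ω × L2vec Ω)))
      = ⋂ φ : E d → ℝ, ⋂ h : IsTest Ω φ, ⋂ i : Fin d,
        {p | inner ℝ ((h.partial_memLp i (volume.restrict Ω)).toLp _) p.fst
          = -inner ℝ ((h.memLp (volume.restrict Ω)).toLp φ)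
            ((EuclideanSpace.proj (𝕜 := ℝ) i : E d →L[ℝ] ℝ).compLpL 2 (volume.restrict Ω)
              p.snd)} := by
    ext p
    simp only [mem_iInter, mem_ofPred_eq]
    refine forall_congr' fun φ => forall_congr' fun h => forall_congr' fun i => ?_
    rw [integral_mul_eq_inner _ (h.partial_memLp i _), integral_coord_mul_eq_inner _ _ (h.memLp _)]
    rfl
  rw [h]
  refine isClosed_iInter fun φ => isClosed_iInter fun h => isClosed_iInter fun i => ?_
  have h1 : Continuous fun p : WithLp 2 (L2 Ω × L2vec Ω) => p.fst :=
    (WithLp.fstL 2 ℝ (L2 Ω) (L2vec Ω)).continuous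
  have h2 : Continuous fun p : WithLp 2 (L2 Ω × L2vec Ω) => p.snd :=
    (WithLp.sndL 2 ℝ (L2 Ω) (L2vec Ω)).continuous
  exact isClosed_eq (continuous_const.inner h1)
    (continuous_const.inner ((ContinuousLinearMap.continuous _).comp h2)).neg

instance (Ω : Set (E d)) : CompleteSpace (H1 Ω) := (isClosed_H1 Ω).completeSpace_coe

instance (Ω : Set (E d)) : CompleteSpace (H10 Ω) :=
  ((testSubspace Ω).isClosed_topologicalClosure).completeSpace_coe

instance (Ω : Set (E d)) : SecondCountableTopology (H10 Ω) := by
  have : Fact ((2 : ENNReal) ≠ ⊤) := ⟨by simp⟩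
  have h1 : SecondCountableTopology (L2 Ω) := inferInstance
  have h2 : SecondCountableTopology (L2vec Ω) := inferInstance
  have h3 : SecondCountableTopology (L2 Ω × L2vec Ω) :=
    @TopologicalSpace.instSecondCountableTopologyProd _ _ _ _ h1 h2
  have : SecondCountableTopology (WithLp 2 (L2 Ω × L2vec Ω)) :=
    (WithLp.homeomorphProd 2 (L2 Ω) (L2vec Ω)).secondCountableTopology
  exact inferInstanceAs (SecondCountableTopology (h10Subspace Ω))

/-- Integration by parts on `Ω` against a test function. -/
theorem integral_mul_partialDeriv {φ ψ : E d → ℝ} (hφ : IsTest Ω φ) (hψ : ContDiff ℝ ∞ ψ)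
    (i : Fin d) :
    ∫ x in Ω, φ x * partialDeriv i ψ x = -∫ x in Ω, partialDeriv i φ x * ψ x := by
  have hcφ := hφ.smooth.continuous
  have hcψ := hψ.continuous
  have hdφ : Continuous (partialDeriv i φ) :=
    (hφ.smooth.continuous_fderiv (by simp)).clm_apply continuous_const
  have hdψ : Continuous (partialDeriv i ψ) :=
    (hψ.continuous_fderiv (by simp)).clm_apply continuous_const
  have hs : HasCompactSupport (partialDeriv i φ) := hφ.compact.fderiv_apply ℝ _
  have hz : ∀ x, x ∉ Ω → φ x = 0 := fun x hx =>
    image_eq_zero_of_notMem_tsupport fun h => hx (hφ.supp h)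
  have hz' : ∀ x, x ∉ Ω → partialDeriv i φ x = 0 := fun x hx =>
    image_eq_zero_of_notMem_tsupport fun h =>
      hx (hφ.supp (tsupport_fderiv_apply_subset ℝ _ h))
  rw [setIntegral_eq_integral_of_forall_compl_eq_zero fun x hx => by rw [hz x hx, zero_mul],
    setIntegral_eq_integral_of_forall_compl_eq_zero fun x hx => by rw [hz' x hx, zero_mul]]
  exact integral_mul_fderiv_eq_neg_fderiv_mul_of_integrable
    ((hdφ.mul hcψ).integrable_of_hasCompactSupport hs.mul_right)
    ((hcφ.mul hdψ).integrable_of_hasCompactSupport hφ.compact.mul_right)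
    ((hcφ.mul hcψ).integrable_of_hasCompactSupport hφ.compact.mul_right)
    (fun x _ => (hφ.smooth.differentiable (by simp)).differentiableAt)
    (fun x _ => (hψ.differentiable (by simp)).differentiableAt)

theorem gradField_memLp {φ : E d → ℝ} (hφ : IsTest Ω φ) :
    MemLp (fun x => (WithLp.toLp 2 fun i => partialDeriv i φ x : E d)) 2 (volume.restrict Ω) := by
  have hc : ∀ i, Continuous (partialDeriv i φ) := fun i =>
    (hφ.smooth.continuous_fderiv (by simp)).clm_apply continuous_const
  refine Continuous.memLp_of_hasCompactSupport (by fun_prop) ?_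
  refine HasCompactSupport.intro hφ.compact.isCompact fun x hx => ?_
  ext i
  exact image_eq_zero_of_notMem_tsupport (f := partialDeriv i φ)
    fun h => hx (tsupport_fderiv_apply_subset ℝ _ h)

/-- Every test function is an element of `H¹₀(Ω)`. -/
theorem IsTest.exists_toL2_ae_eq {φ : E d → ℝ} (hφ : IsTest Ω φ) :
    ∃ v : H10 Ω, toL2 Ω v =ᵐ[volume.restrict Ω] φ := by
  have hm := hφ.memLp (volume.restrict Ω)
  let p : WithLp 2 (L2 Ω × L2vec Ω) := WithLp.toLp 2 (hm.toLp φ, (gradField_memLp hφ).toLp _)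
  have hp : IsWeakGrad Ω p.fst p.snd := by
    intro ψ hψ i
    have h1 : ∫ x in Ω, p.fst x * partialDeriv i ψ x = ∫ x in Ω, φ x * partialDeriv i ψ x := by
      refine integral_congr_ae ?_
      filter_upwards [hm.coeFn_toLp] with x hx
      change hm.toLp φ x * _ = _
      rw [hx]
    have h2 : ∫ x in Ω, p.snd x i * ψ x = ∫ x in Ω, partialDeriv i φ x * ψ x := by
      refine integral_congr_ae ?_
      filter_upwards [(gradField_memLp hφ).coeFn_toLp] with x hx
      change (gradField_memLp hφ).toLp _ x i * _ = _
      rw [hx]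
    rw [h1, h2, integral_mul_partialDeriv hφ hψ.smooth]
  have ht : (⟨p, hp⟩ : H1 Ω) ∈ testSubspace Ω := ⟨φ, hφ, hm.coeFn_toLp⟩
  exact ⟨⟨⟨p, hp⟩, (testSubspace Ω).le_topologicalClosure ht⟩, hm.coeFn_toLp⟩

/-- A square-integrable function on `Ω` that is orthogonal to all test functions vanishes. -/
theorem ae_eq_zero_of_forall_isTest (hΩ : IsOpen Ω) {f : E d → ℝ}
    (hf : MemLp f 2 (volume.restrict Ω))
    (h : ∀ φ : E d → ℝ, IsTest Ω φ → ∫ x in Ω, f x * φ x = 0) : f =ᵐ[volume.restrict Ω] 0 := by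
  have hli : LocallyIntegrableOn f Ω :=
    locallyIntegrableOn_of_locallyIntegrable_restrict (hf.locallyIntegrable (by norm_num))
  have key := hΩ.ae_eq_zero_of_integral_contDiff_smul_eq_zero hli fun φ h1 h2 h3 => by
    rw [← h φ ⟨h1, h2, h3⟩, ← setIntegral_eq_integral_of_forall_compl_eq_zero (s := Ω)]
    · simp only [smul_eq_mul, mul_comm]
    · intro x hx
      rw [image_eq_zero_of_notMem_tsupport fun h => hx (h3 h), zero_smul]
  rw [Filter.EventuallyEq, ae_restrict_iff' hΩ.measurableSet]
  exact key

/-- `H¹₀(Ω)` is dense in `L²(Ω)`: only the zero vector is orthogonal to its image. -/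
theorem eq_zero_of_forall_inner_toL2 (hΩ : IsOpen Ω) {h : L2 Ω}
    (hh : ∀ v : H10 Ω, inner ℝ h (toL2 Ω v) = 0) : h = 0 := by
  refine (Lp.eq_zero_iff_ae_eq_zero).2 (ae_eq_zero_of_forall_isTest hΩ (Lp.memLp h) fun φ hφ => ?_)
  obtain ⟨v, hv⟩ := hφ.exists_toL2_ae_eq
  rw [← hh v, L2.inner_def]
  refine integral_congr_ae ?_
  filter_upwards [hv] with x hx
  rw [hx]
  exact mul_comm _ _

/-- The embedding `H¹₀(Ω) → L²(Ω)` is injective, since weak gradients are unique. -/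
theorem toL2_injective (hΩ : IsOpen Ω) : Function.Injective (toL2 Ω) := by
  rw [injective_iff_map_eq_zero]
  intro v hv
  have h1 : v.1.1.fst = 0 := hv
  have h2 : v.1.1.snd = 0 := by
    have hi : ∀ i : Fin d, (fun x => v.1.1.snd x i) =ᵐ[volume.restrict Ω] 0 := fun i =>
      ae_eq_zero_of_forall_isTest hΩ (coord_memLp _ i) fun φ hφ => by
        have h3 := v.1.2 φ hφ i
        rw [h1, integral_mul_eq_inner _ (hφ.partial_memLp i _), inner_zero_right] at h3
        linarith
    refine (Lp.eq_zero_iff_ae_eq_zero).2 ?_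
    filter_upwards [ae_all_iff.2 hi] with x hx
    ext i
    exact hx i
  exact Subtype.ext (Subtype.ext (WithLp.ofLp_injective 2 (Prod.ext h1 h2)))

/-- The Poincaré inequality. For a test function `φ`, integrating `∂ᵢ(xᵢ φ²)` gives
`½ ‖φ‖² = -(∂ᵢφ, xᵢ φ)`. -/
theorem exists_poincare (hd : 1 ≤ d) (hΩb : Bornology.IsBounded Ω) :
    ∃ C : ℝ, ∀ v : H10 Ω, ‖toL2 Ω v‖ ≤ C * ‖grad Ω v‖ := by
  obtain ⟨R, hR0, hR⟩ := hΩb.exists_pos_norm_le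
  let i : Fin d := ⟨0, hd⟩
  refine ⟨2 * R, ?_⟩
  have htest : ∀ p ∈ testSubspace Ω, ‖p.1.fst‖ ≤ 2 * R * ‖p.1.snd‖ := by
    rintro p ⟨φ, hφ, hp⟩
    set ψ : E d → ℝ := fun x => x i * φ x
    have hpr : ContDiff ℝ ∞ (fun x : E d => x i) :=
      (EuclideanSpace.proj (𝕜 := ℝ) i : E d →L[ℝ] ℝ).contDiff
    have hψ : IsTest Ω ψ := ⟨hpr.mul hφ.smooth, hφ.compact.mul_left,
      (tsupport_mul_subset_right).trans hφ.supp⟩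
    have hdψ : ∀ x, partialDeriv i ψ x = φ x + x i * partialDeriv i φ x := by
      intro x
      have h1 : HasFDerivAt (fun x : E d => x i) (EuclideanSpace.proj (𝕜 := ℝ) i : E d →L[ℝ] ℝ) x :=
        (EuclideanSpace.proj (𝕜 := ℝ) i : E d →L[ℝ] ℝ).hasFDerivAt
      have h2 := (hφ.smooth.differentiable (by simp)).differentiableAt (x := x) |>.hasFDerivAt
      unfold partialDeriv
      rw [show ψ = (fun x : E d => x i) * φ from rfl, (h1.mul h2).fderiv]
      simp [add_comm]
    have hφ2 := hφ.memLp (volume.restrict Ω)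
    have hψ2 := hψ.memLp (volume.restrict Ω)
    have hdφ2 := hφ.partial_memLp i (volume.restrict Ω)
    -- the sum of the two expressions for `A` gives `A = ½ ‖φ‖²`
    set A := ∫ x in Ω, φ x * partialDeriv i ψ x with hA
    have hA1 : A = -∫ x in Ω, partialDeriv i φ x * ψ x := integral_mul_partialDeriv hφ hψ.smooth i
    have hA2 : A = (∫ x in Ω, φ x * φ x) + ∫ x in Ω, partialDeriv i φ x * ψ x := by
      have h1 : IntegrableOn (fun x => φ x * φ x) Ω := hφ2.integrable_mul hφ2
      have h2 : IntegrableOn (fun x => partialDeriv i φ x * ψ x) Ω := hdφ2.integrable_mul hψ2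
      rw [hA, ← integral_add h1 h2]
      refine integral_congr_ae (ae_of_all _ fun x => ?_)
      simp only [hdψ, ψ]; ring
    have hn : ∫ x in Ω, φ x * φ x = ‖p.1.fst‖ ^ 2 := by
      rw [← real_inner_self_eq_norm_sq, L2.inner_def]
      refine integral_congr_ae ?_
      filter_upwards [hp] with x hx
      rw [hx]; rfl
    have hw : A = -∫ x in Ω, p.1.snd x i * ψ x := by
      rw [← p.2 ψ hψ i, hA]
      refine integral_congr_ae ?_
      filter_upwards [hp] with x hx
      rw [hx]
    rw [integral_coord_mul_eq_inner _ _ hψ2] at hw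
    set G := (EuclideanSpace.proj (𝕜 := ℝ) i : E d →L[ℝ] ℝ).compLp p.1.snd
    have hG : ‖G‖ ≤ ‖p.1.snd‖ := by
      rw [← one_mul ‖p.1.snd‖]
      refine Lp.norm_le_mul_norm_of_ae_le_mul ?_
      filter_upwards [(EuclideanSpace.proj (𝕜 := ℝ) i : E d →L[ℝ] ℝ).coeFn_compLp p.1.snd] with x hx
      rw [hx, one_mul]
      exact PiLp.norm_apply_le _ i
    have hψn : ‖hψ2.toLp ψ‖ ≤ R * ‖p.1.fst‖ := by
      refine Lp.norm_le_mul_norm_of_ae_le_mul ?_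
      filter_upwards [hψ2.coeFn_toLp, hp] with x hx hx'
      rw [hx, hx']
      simp only [ψ, norm_mul]
      by_cases hxΩ : x ∈ Ω
      · exact mul_le_mul_of_nonneg_right ((PiLp.norm_apply_le _ i).trans (hR x hxΩ)) (norm_nonneg _)
      · rw [image_eq_zero_of_notMem_tsupport fun h => hxΩ (hφ.supp h)]; simp
    have h3 := abs_real_inner_le_norm (hψ2.toLp ψ) G
    have h4 : ‖hψ2.toLp ψ‖ * ‖G‖ ≤ R * ‖p.1.fst‖ * ‖p.1.snd‖ :=
      mul_le_mul hψn hG (norm_nonneg _) (by positivity)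
    have h5 : ‖p.1.fst‖ ^ 2 ≤ 2 * R * ‖p.1.snd‖ * ‖p.1.fst‖ := by
      have := (abs_le.1 (h3.trans h4)).1
      nlinarith
    rcases (norm_nonneg p.1.fst).eq_or_lt with h0 | h0
    · rw [← h0]; positivity
    · exact le_of_mul_le_mul_right (by linarith [sq ‖p.1.fst‖]) h0
  have hcl : IsClosed {p : H1 Ω | ‖p.1.fst‖ ≤ 2 * R * ‖p.1.snd‖} := by
    have h1 : Continuous fun p : H1 Ω => p.1.fst :=
      (WithLp.fstL 2 ℝ (L2 Ω) (L2vec Ω)).continuous.comp continuous_subtype_val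
    have h2 : Continuous fun p : H1 Ω => p.1.snd :=
      (WithLp.sndL 2 ℝ (L2 Ω) (L2vec Ω)).continuous.comp continuous_subtype_val
    exact isClosed_le h1.norm (continuous_const.mul h2.norm)
  intro v
  exact closure_minimal htest hcl v.2

/-- On `H¹₀(Ω)` the gradient norm is equivalent to the `H¹`-norm. -/
theorem exists_norm_le_grad (hd : 1 ≤ d) (hΩb : Bornology.IsBounded Ω) :
    ∃ C : ℝ, 0 < C ∧ ∀ v : H10 Ω, ‖v‖ ≤ C * ‖grad Ω v‖ := by
  obtain ⟨C, hC⟩ := exists_poincare hd hΩb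
  refine ⟨|C| + 1, by positivity, fun v => ?_⟩
  have h : ‖v‖ ^ 2 = ‖toL2 Ω v‖ ^ 2 + ‖grad Ω v‖ ^ 2 := WithLp.prod_norm_sq_eq_of_L2 v.1.1
  have h1 : ‖toL2 Ω v‖ ≤ |C| * ‖grad Ω v‖ :=
    (hC v).trans (mul_le_mul_of_nonneg_right (le_abs_self C) (norm_nonneg _))
  refine le_of_sq_le_sq ?_ (by positivity)
  calc ‖v‖ ^ 2 ≤ (|C| * ‖grad Ω v‖) ^ 2 + ‖grad Ω v‖ ^ 2 := by rw [h]; gcongr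
    _ ≤ ((|C| + 1) * ‖grad Ω v‖) ^ 2 := by
      have := mul_nonneg (abs_nonneg C) (sq_nonneg ‖grad Ω v‖)
      nlinarith

end Space

/-! ### Traces in time and integration by parts in `Y` -/

section Traces

variable {d : ℕ} {Ω : Set (E d)} {T : ℝ}

theorem exists_isContRep_energy (hΩ : IsOpen Ω) (hT : 0 < T) (φ : Y Ω T) :
    ∃ c : ℝ → L2 Ω, IsContRep φ c ∧
      ‖c T‖ ^ 2 = ‖c 0‖ ^ 2 + 2 * ∫ t in Ioo 0 T, dt φ t (incl φ t) := by
  obtain ⟨c, h1, h2, h3⟩ := exists_continuousOn_rep (toL2 Ω) (toL2_injective hΩ) (toHm1 Ω)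
    (toHm1_apply Ω) hT (Lp.memLp (incl φ)) (Lp.memLp (dt φ)) φ.2
  exact ⟨c, ⟨h1, h2⟩, h3⟩

theorem IsContRep.eqOn (hT : 0 < T) {φ : Y Ω T} {c c' : ℝ → L2 Ω} (h : IsContRep φ c)
    (h' : IsContRep φ c') : EqOn c c' (Icc 0 T) := by
  refine Measure.eqOn_Icc_of_ae_eq volume hT.ne ?_ h.1 h'.1
  rw [← Measure.restrict_congr_set Ioo_ae_eq_Icc]
  filter_upwards [h.2, h'.2] with t h1 h2
  rw [h1, h2]

theorem isContRep_valAt (hΩ : IsOpen Ω) (hT : 0 < T) (φ : Y Ω T) : IsContRep φ (valAt φ) := by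
  have h : ∃ c : ℝ → L2 Ω, IsContRep φ c := (exists_isContRep_energy hΩ hT φ).imp fun _ h => h.1
  have h1 : valAt φ = h.choose := funext fun s => dif_pos h
  rw [h1]
  exact h.choose_spec

theorem IsContRep.valAt_eq (hΩ : IsOpen Ω) (hT : 0 < T) {φ : Y Ω T} {c : ℝ → L2 Ω}
    (h : IsContRep φ c) {s : ℝ} (hs : s ∈ Icc 0 T) : valAt φ s = c s :=
  (isContRep_valAt hΩ hT φ).eqOn hT h hs

theorem valAt_add (hΩ : IsOpen Ω) (hT : 0 < T) (φ ψ : Y Ω T) {s : ℝ} (hs : s ∈ Icc 0 T) :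
    valAt (φ + ψ) s = valAt φ s + valAt ψ s := by
  have h1 := isContRep_valAt hΩ hT φ
  have h2 := isContRep_valAt hΩ hT ψ
  refine IsContRep.valAt_eq hΩ hT (c := fun s => valAt φ s + valAt ψ s) ⟨h1.1.add h2.1, ?_⟩ hs
  filter_upwards [h1.2, h2.2, Lp.coeFn_add (incl φ) (incl ψ)] with t ht1 ht2 ht3
  change _ = toL2 Ω ((incl φ + incl ψ : X Ω T) t)
  rw [ht1, ht2, ht3, Pi.add_apply, map_add]

theorem valAt_smul (hΩ : IsOpen Ω) (hT : 0 < T) (a : ℝ) (φ : Y Ω T) {s : ℝ} (hs : s ∈ Icc 0 T) :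
    valAt (a • φ) s = a • valAt φ s := by
  have h1 := isContRep_valAt hΩ hT φ
  refine IsContRep.valAt_eq hΩ hT (c := fun s => a • valAt φ s) ⟨h1.1.const_smul a, ?_⟩ hs
  filter_upwards [h1.2, Lp.coeFn_smul a (incl φ)] with t ht1 ht2
  change _ = toL2 Ω ((a • incl φ : X Ω T) t)
  rw [ht1, ht2, Pi.smul_apply, map_smul]

/-- The energy identity for the elements of `Y`. -/
theorem norm_valAt_sq (hΩ : IsOpen Ω) (hT : 0 < T) (φ : Y Ω T) :
    ‖valAt φ T‖ ^ 2 = ‖valAt φ 0‖ ^ 2 + 2 * ∫ t in Ioo 0 T, dt φ t (incl φ t) := by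
  obtain ⟨c, hc, h⟩ := exists_isContRep_energy hΩ hT φ
  rw [hc.valAt_eq hΩ hT ⟨hT.le, le_rfl⟩, hc.valAt_eq hΩ hT ⟨le_rfl, hT.le⟩, h]

theorem integrable_dual_apply (w : L2t T (Hm1 Ω)) (v : X Ω T) :
    IntegrableOn (fun t => w t (v t)) (Ioo 0 T) := by
  refine Integrable.mono' ((Lp.memLp w).norm.integrable_mul (Lp.memLp v).norm) ?_
    (ae_of_all _ fun t => (w t).le_opNorm (v t))
  exact (ContinuousLinearMap.apply ℝ ℝ (E := H10 Ω)).aestronglyMeasurable_comp₂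
    (Lp.memLp v).1 (Lp.memLp w).1

theorem integral_dual_add (w w' : L2t T (Hm1 Ω)) (v v' : X Ω T) :
    ∫ t in Ioo 0 T, (w + w') t ((v + v') t)
      = (∫ t in Ioo 0 T, w t (v t)) + (∫ t in Ioo 0 T, w' t (v' t))
        + ∫ t in Ioo 0 T, (w t (v' t) + w' t (v t)) := by
  have h1 : IntegrableOn (fun t => w t (v t) + w' t (v' t)) (Ioo 0 T) :=
    (integrable_dual_apply w v).add (integrable_dual_apply w' v')
  have h2 : IntegrableOn (fun t => w t (v' t) + w' t (v t)) (Ioo 0 T) :=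
    (integrable_dual_apply w v').add (integrable_dual_apply w' v)
  rw [← integral_add (integrable_dual_apply w v) (integrable_dual_apply w' v'),
    ← integral_add h1 h2]
  refine integral_congr_ae ?_
  filter_upwards [Lp.coeFn_add w w', Lp.coeFn_add v v'] with t h1 h2
  rw [h1, h2]
  simp only [Pi.add_apply, map_add, add_apply]
  ring

/-- Integration by parts in time, by polarization of the energy identity. -/
theorem integral_dt_add_dt (hΩ : IsOpen Ω) (hT : 0 < T) (φ ψ : Y Ω T) :
    ∫ t in Ioo 0 T, (dt φ t (incl ψ t) + dt ψ t (incl φ t))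
      = inner ℝ (valAt φ T) (valAt ψ T) - inner ℝ (valAt φ 0) (valAt ψ 0) := by
  have h := norm_valAt_sq hΩ hT (φ + ψ)
  rw [valAt_add hΩ hT φ ψ ⟨hT.le, le_rfl⟩, valAt_add hΩ hT φ ψ ⟨le_rfl, hT.le⟩, norm_add_sq_real,
    norm_add_sq_real] at h
  have h1 := integral_dual_add (dt φ) (dt ψ) (incl φ) (incl ψ)
  have h2 : ∫ t in Ioo 0 T, dt (φ + ψ) t (incl (φ + ψ) t)
      = ∫ t in Ioo 0 T, (dt φ + dt ψ) t ((incl φ + incl ψ) t) := rfl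
  rw [h2, h1] at h
  linarith [norm_valAt_sq hΩ hT φ, norm_valAt_sq hΩ hT ψ]

theorem memLp_of_continuous {V : Type*} [NormedAddCommGroup V] {f : ℝ → V} (hf : Continuous f)
    (T : ℝ) : MemLp f 2 (volume.restrict (Ioo 0 T)) := by
  obtain ⟨C, hC⟩ := (isCompact_Icc (a := (0 : ℝ)) (b := T)).exists_bound_of_continuousOn
    hf.continuousOn
  refine MemLp.of_bound hf.aestronglyMeasurable C ?_
  filter_upwards [ae_restrict_mem measurableSet_Ioo] with t ht
  exact hC t (Ioo_subset_Icc_self ht)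

/-- For `η` smooth on `ℝ` and `w ∈ H¹₀(Ω)`, the element `t ↦ η(t) w` of `Y`. -/
theorem exists_tensor (hΩ : IsOpen Ω) (hT : 0 < T) {η : ℝ → ℝ} (hη : ContDiff ℝ ∞ η) (w : H10 Ω) :
    ∃ φ : Y Ω T, (∀ᵐ t ∂(volume.restrict (Ioo 0 T)), incl φ t = η t • w) ∧
      (∀ᵐ t ∂(volume.restrict (Ioo 0 T)), dt φ t = deriv η t • toHm1 Ω w) ∧
      ∀ s ∈ Icc 0 T, valAt φ s = η s • toL2 Ω w := by
  have hd : Continuous (deriv η) := hη.continuous_deriv (by simp)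
  have hφ : MemLp (fun t => η t • w) 2 (volume.restrict (Ioo 0 T)) :=
    memLp_of_continuous (hη.continuous.smul continuous_const) T
  have hdφ : MemLp (fun t => deriv η t • toHm1 Ω w) 2 (volume.restrict (Ioo 0 T)) :=
    memLp_of_continuous (hd.smul continuous_const) T
  have hweak : IsWeakTimeDeriv (hφ.toLp _) (hdφ.toLp _) := by
    intro θ hθ
    have h1 : ∫ t in Ioo 0 T, deriv θ t • toHm1 Ω (hφ.toLp _ t)
        = (∫ t in Ioo 0 T, deriv θ t * η t) • toHm1 Ω w := by
      refine Eq.trans (integral_congr_ae ?_) (integral_smul_const _ _)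
      filter_upwards [hφ.coeFn_toLp] with t ht
      rw [ht, map_smul, smul_smul]
    have h2 : ∫ t in Ioo 0 T, θ t • hdφ.toLp _ t
        = (∫ t in Ioo 0 T, θ t * deriv η t) • toHm1 Ω w := by
      refine Eq.trans (integral_congr_ae ?_) (integral_smul_const _ _)
      filter_upwards [hdφ.coeFn_toLp] with t ht
      rw [ht, smul_smul]
    have h3 : ∫ t in (0 : ℝ)..T, (deriv θ t * η t + θ t * deriv η t) = θ T * η T - θ 0 * η 0 :=
      intervalIntegral.integral_eq_sub_of_hasDerivAt
        (fun t _ => ((hθ.smooth.differentiable (by simp)).differentiableAt.hasDerivAt).mul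
          ((hη.differentiable (by simp)).differentiableAt.hasDerivAt))
        (((hθ.deriv.smooth.continuous.mul hη.continuous).add
          (hθ.smooth.continuous.mul hd)).intervalIntegrable _ _)
    rw [intervalIntegral.integral_of_le hT.le, integral_Ioc_eq_integral_Ioo, integral_add,
      hθ.eq_zero (t := T) (by simp), hθ.eq_zero (t := 0) (by simp), zero_mul, zero_mul,
      sub_zero] at h3
    · rw [h1, h2, eq_neg_of_add_eq_zero_left h3]
      exact neg_smul (∫ t in Ioo 0 T, θ t * deriv η t) (toHm1 Ω w)
    · exact hθ.deriv.integrable_smul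
        ((memLp_of_continuous hη.continuous T).integrable (by norm_num))
    · exact hθ.integrable_smul ((memLp_of_continuous hd T).integrable (by norm_num))
  refine ⟨⟨(hφ.toLp _, hdφ.toLp _), hweak⟩, hφ.coeFn_toLp, hdφ.coeFn_toLp, fun s hs => ?_⟩
  refine IsContRep.valAt_eq hΩ hT (c := fun s => η s • toL2 Ω w)
    ⟨(hη.continuous.smul continuous_const).continuousOn, ?_⟩ hs
  filter_upwards [hφ.coeFn_toLp] with t ht
  change _ = toL2 Ω (hφ.toLp _ t)
  rw [ht, map_smul]

end Traces

/-! ### The isometric realization of `Z` and the operator `φ ↦ (φ - A⁻¹∂ₜφ, 2φ(T))` -/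

/-- If `y` lies in the closure of the range of `f`, then `‖y‖` is the supremum of
`⟨y, f v⟩ / ‖f v‖`. -/
theorem isLUB_inner_div_norm {M N : Type*} [AddCommGroup M] [Module ℝ M] [Nontrivial M]
    [NormedAddCommGroup N] [InnerProductSpace ℝ N] {f : M →ₗ[ℝ] N} (hf : Function.Injective f)
    {y : N} (hy : y ∈ closure (range f)) :
    IsLUB {r : ℝ | ∃ v : M, v ≠ 0 ∧ r = inner ℝ y (f v) / ‖f v‖} ‖y‖ := by
  have hpos : ∀ v, v ≠ 0 → 0 < ‖f v‖ := fun v hv =>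
    norm_pos_iff.2 ((map_ne_zero_iff f hf).2 hv)
  constructor
  · rintro r ⟨v, hv, rfl⟩
    rw [div_le_iff₀ (hpos v hv)]
    exact real_inner_le_norm _ _
  · intro b hb
    have hcl : IsClosed {z : N | inner ℝ y z ≤ b * ‖z‖} :=
      isClosed_le (continuous_const.inner continuous_id) (continuous_const.mul continuous_norm)
    have hsub : range f ⊆ {z : N | inner ℝ y z ≤ b * ‖z‖} := by
      rintro _ ⟨v, rfl⟩
      rcases eq_or_ne v 0 with rfl | hv
      · simp
      · exact (div_le_iff₀ (hpos v hv)).1 (hb ⟨v, hv, rfl⟩)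
    have h1 : inner ℝ y y ≤ b * ‖y‖ := closure_minimal hsub hcl hy
    rw [real_inner_self_eq_norm_sq, sq] at h1
    rcases (norm_nonneg y).eq_or_lt with h0 | h0
    · obtain ⟨v, hv⟩ := exists_ne (0 : M)
      have h2 := hb ⟨v, hv, rfl⟩
      rw [norm_eq_zero.1 h0.symm] at h2 ⊢
      simpa using h2
    · exact le_of_mul_le_mul_right h1 h0

section Main

variable {d : ℕ} {Ω : Set (E d)} {T : ℝ}

/-- The negative Dirichlet Laplacian `A = -Δ : H¹₀(Ω) → H⁻¹(Ω)`, `⟨A w, v⟩ = (∇w, ∇v)`. -/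
noncomputable def negLaplacian (Ω : Set (E d)) : H10 Ω →L[ℝ] Hm1 Ω :=
  (ContinuousLinearMap.precomp ℝ (grad Ω)).comp ((innerSL ℝ (E := L2vec Ω)).comp (grad Ω))

theorem negLaplacian_apply (w v : H10 Ω) :
    negLaplacian Ω w v = inner ℝ (grad Ω w) (grad Ω v) := rfl

/-- The inverse of `A = -Δ`, by Lax–Milgram. -/
theorem exists_inverse_negLaplacian (hd : 1 ≤ d) (hΩb : Bornology.IsBounded Ω) :
    ∃ S : Hm1 Ω →L[ℝ] H10 Ω, ∀ Φ v, inner ℝ (grad Ω (S Φ)) (grad Ω v) = Φ v := by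
  obtain ⟨C, hC, h⟩ := exists_norm_le_grad hd hΩb
  have hco : IsCoercive (negLaplacian Ω) := by
    refine ⟨(C ^ 2)⁻¹, by positivity, fun v => ?_⟩
    rw [negLaplacian_apply, real_inner_self_eq_norm_sq, mul_assoc, ← sq,
      inv_mul_le_iff₀ (by positivity), ← mul_pow]
    gcongr
    exact h v
  let ι : Hm1 Ω →L[ℝ] H10 Ω :=
    ((InnerProductSpace.toDual ℝ (H10 Ω)).symm.toContinuousLinearEquiv : Hm1 Ω →L⋆[ℝ] H10 Ω)
  have hι : ∀ Φ x, inner ℝ (ι Φ) x = Φ x := fun Φ x =>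
    InnerProductSpace.toDual_symm_apply (𝕜 := ℝ) (E := H10 Ω)
  refine ⟨(hco.continuousLinearEquivOfBilin.symm : H10 Ω →L[ℝ] H10 Ω).comp ι, fun Φ v => ?_⟩
  rw [← negLaplacian_apply, ← hco.continuousLinearEquivOfBilin_apply, ← hι]
  simp

/-- The dual norm is attained at the Riesz representative `S Φ = A⁻¹ Φ`. -/
theorem hm1Norm_eq {C : ℝ} (hC : ∀ v : H10 Ω, ‖v‖ ≤ C * ‖grad Ω v‖) {S : Hm1 Ω →L[ℝ] H10 Ω}
    (hS : ∀ Φ v, inner ℝ (grad Ω (S Φ)) (grad Ω v) = Φ v) (Φ : Hm1 Ω) :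
    hm1Norm Φ = ‖grad Ω (S Φ)‖ := by
  have h0 : ∀ v : H10 Ω, grad Ω v = 0 → v = 0 := fun v hv => by
    have := hC v
    rw [hv, norm_zero, mul_zero] at this
    exact norm_le_zero_iff.1 this
  unfold hm1Norm
  rcases subsingleton_or_nontrivial (H10 Ω) with hs | hn
  · have h1 : {r : ℝ | ∃ v : H10 Ω, v ≠ 0 ∧ r = Φ v / ‖grad Ω v‖} = ∅ := by
      ext r
      simp only [mem_ofPred_eq, mem_empty_iff_false, iff_false]
      rintro ⟨v, hv, -⟩
      exact hv (Subsingleton.elim _ _)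
    rw [h1, Real.sSup_empty, Subsingleton.elim (S Φ) 0, map_zero, norm_zero]
  · have h := isLUB_inner_div_norm (f := (grad Ω : H10 Ω →ₗ[ℝ] L2vec Ω))
      ((injective_iff_map_eq_zero _).2 h0) (subset_closure ⟨S Φ, rfl⟩ :
        grad Ω (S Φ) ∈ closure (range (grad Ω : H10 Ω →ₗ[ℝ] L2vec Ω)))
    simp only [ContinuousLinearMap.coe_coe, hS] at h
    obtain ⟨v, hv⟩ := exists_ne (0 : H10 Ω)
    exact h.csSup_eq ⟨_, v, hv, rfl⟩

/-- The isometric embedding `(v, v_T) ↦ (∇v, v_T/√2)` of `Z`, with the norm `‖·‖_Z`, into a Hilbert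
space. -/
noncomputable def zEmb (Ω : Set (E d)) (T : ℝ) : Z Ω T →L[ℝ] WithLp 2 (L2t T (L2vec Ω) × L2 Ω) :=
  (WithLp.prodContinuousLinearEquiv 2 ℝ (L2t T (L2vec Ω)) (L2 Ω)).symm.toContinuousLinearMap.comp
    (((grad Ω).compLpL 2 (volume.restrict (Ioo 0 T))).prodMap
      ((Real.sqrt 2)⁻¹ • ContinuousLinearMap.id ℝ (L2 Ω)))

theorem inner_zEmb (v w : Z Ω T) :
    inner ℝ (zEmb Ω T v) (zEmb Ω T w)
      = (∫ t in Ioo 0 T, inner ℝ (grad Ω (v.1 t)) (grad Ω (w.1 t)))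
        + (1 / 2) * inner ℝ v.2 w.2 := by
  rw [WithLp.prod_inner_apply]
  congr 1
  · change inner ℝ ((grad Ω).compLp v.1) ((grad Ω).compLp w.1) = _
    rw [L2.inner_def]
    refine integral_congr_ae ?_
    filter_upwards [(grad Ω).coeFn_compLp v.1, (grad Ω).coeFn_compLp w.1] with t h1 h2
    rw [h1, h2]
  · change inner ℝ ((Real.sqrt 2)⁻¹ • v.2) ((Real.sqrt 2)⁻¹ • w.2) = _
    rw [real_inner_smul_left, real_inner_smul_right, ← mul_assoc, ← mul_inv,
      Real.mul_self_sqrt (by norm_num), one_div]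

theorem integral_grad_sq_nonneg (v : X Ω T) : 0 ≤ ∫ t in Ioo 0 T, ‖grad Ω (v t)‖ ^ 2 :=
  integral_nonneg fun _ => sq_nonneg _

theorem norm_zEmb (v : Z Ω T) : ‖zEmb Ω T v‖ = zNorm v := by
  rw [norm_eq_sqrt_real_inner, inner_zEmb, zNorm, xNorm, Real.sq_sqrt (integral_grad_sq_nonneg _)]
  simp only [real_inner_self_eq_norm_sq]

theorem antilipschitz_zEmb (hd : 1 ≤ d) (hΩb : Bornology.IsBounded Ω) :
    ∃ K : NNReal, AntilipschitzWith K (zEmb Ω T) := by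
  obtain ⟨C, hC, h⟩ := exists_norm_le_grad hd hΩb
  have hs : (0 : ℝ) < Real.sqrt 2 := by positivity
  refine ⟨⟨max C (Real.sqrt 2), by positivity⟩, ContinuousLinearMap.antilipschitz_of_bound _
    fun v => ?_⟩
  have h1 : ‖v.1‖ ≤ C * ‖(grad Ω).compLp v.1‖ := by
    refine Lp.norm_le_mul_norm_of_ae_le_mul ?_
    filter_upwards [(grad Ω).coeFn_compLp v.1] with t ht
    rw [ht]; exact h _
  have h2 : ‖(grad Ω).compLp v.1‖ ≤ ‖zEmb Ω T v‖ := WithLp.norm_fst_le (p := 2) _ (zEmb Ω T v)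
  have h3 : ‖(Real.sqrt 2)⁻¹ • v.2‖ ≤ ‖zEmb Ω T v‖ := WithLp.norm_snd_le (p := 2) _ (zEmb Ω T v)
  rw [norm_smul, norm_inv, Real.norm_of_nonneg hs.le, inv_mul_le_iff₀ hs] at h3
  rw [Prod.norm_def]
  change max ‖v.1‖ ‖v.2‖ ≤ max C (Real.sqrt 2) * _
  refine max_le ((h1.trans (mul_le_mul_of_nonneg_left h2 hC.le)).trans ?_) (h3.trans ?_)
  · exact mul_le_mul_of_nonneg_right (le_max_left _ _) (norm_nonneg _)
  · exact mul_le_mul_of_nonneg_right (le_max_right _ _) (norm_nonneg _)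

/-- The linear map `φ ↦ (φ - S ∂ₜφ, 2 φ(T))` from `Y` to `Z`. For `S` the inverse of `A`,
it represents `B_Z(·, φ)` with respect to the inner product of `Z`. -/
noncomputable def riesz (hΩ : IsOpen Ω) (hT : 0 < T) (S : Hm1 Ω →L[ℝ] H10 Ω) :
    Y Ω T →ₗ[ℝ] Z Ω T where
  toFun φ := (incl φ - S.compLp (dt φ), (2 : ℝ) • valAt φ T)
  map_add' φ ψ := by
    rw [valAt_add hΩ hT φ ψ ⟨hT.le, le_rfl⟩]
    refine Prod.ext ?_ (smul_add _ _ _)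
    change (incl φ + incl ψ) - S.compLpL 2 (volume.restrict (Ioo 0 T)) (dt φ + dt ψ)
      = (incl φ - S.compLpL 2 _ (dt φ)) + (incl ψ - S.compLpL 2 _ (dt ψ))
    rw [map_add]; abel
  map_smul' a φ := by
    rw [valAt_smul hΩ hT a φ ⟨hT.le, le_rfl⟩]
    refine Prod.ext ?_ (smul_comm _ _ _)
    change a • incl φ - S.compLpL 2 (volume.restrict (Ioo 0 T)) (a • dt φ)
      = a • (incl φ - S.compLpL 2 _ (dt φ))
    rw [map_smul, smul_sub]

theorem riesz_fst_ae (hΩ : IsOpen Ω) (hT : 0 < T) (S : Hm1 Ω →L[ℝ] H10 Ω) (φ : Y Ω T) :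
    ∀ᵐ t ∂(volume.restrict (Ioo 0 T)), (riesz hΩ hT S φ).1 t = incl φ t - S (dt φ t) := by
  filter_upwards [Lp.coeFn_sub (incl φ) (S.compLp (dt φ)), S.coeFn_compLp (dt φ)] with t h1 h2
  change (incl φ - S.compLp (dt φ) : X Ω T) t = _
  rw [h1, Pi.sub_apply, h2]

theorem BZ_eq_inner {S : Hm1 Ω →L[ℝ] H10 Ω}
    (hS : ∀ Φ v, inner ℝ (grad Ω (S Φ)) (grad Ω v) = Φ v) (hΩ : IsOpen Ω) (hT : 0 < T)
    (v : Z Ω T) (φ : Y Ω T) :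
    BZ v φ = inner ℝ (zEmb Ω T v) (zEmb Ω T (riesz hΩ hT S φ)) := by
  rw [inner_zEmb, BZ, add_comm]
  congr 1
  · refine integral_congr_ae ?_
    filter_upwards [riesz_fst_ae hΩ hT S φ] with t ht
    rw [ht, map_sub, inner_sub_right, ← hS (dt φ t), real_inner_comm (grad Ω (incl φ t)),
      real_inner_comm (grad Ω (S (dt φ t)))]
    ring
  · change _ = 1 / 2 * inner ℝ v.2 ((2 : ℝ) • valAt φ T)
    rw [real_inner_smul_right]; ring

/-- The norm `‖·‖_{Y*}` is the one pulled back from `Z` along `riesz`: the cross term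
`-2 ∫ ⟨∂ₜφ, φ⟩ = ‖φ(0)‖² - ‖φ(T)‖²` turns the contribution `2 ‖φ(T)‖²` of the second component into
`‖φ(0)‖² + ‖φ(T)‖²`. -/
theorem norm_zEmb_riesz {C : ℝ} (hC : ∀ v : H10 Ω, ‖v‖ ≤ C * ‖grad Ω v‖)
    {S : Hm1 Ω →L[ℝ] H10 Ω} (hS : ∀ Φ v, inner ℝ (grad Ω (S Φ)) (grad Ω v) = Φ v)
    (hΩ : IsOpen Ω) (hT : 0 < T) (φ : Y Ω T) :
    ‖zEmb Ω T (riesz hΩ hT S φ)‖ = ysNorm φ := by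
  have hi : IntegrableOn (fun t => hm1Norm (dt φ t) ^ 2 + ‖grad Ω (incl φ t)‖ ^ 2) (Ioo 0 T) := by
    simp only [hm1Norm_eq hC hS]
    exact ((((grad Ω).comp S).comp_memLp' (Lp.memLp (dt φ))).integrable_norm_pow (by norm_num)).add
      (((grad Ω).comp_memLp' (Lp.memLp (incl φ))).integrable_norm_pow (by norm_num))
  have h1 : ∫ t in Ioo 0 T, inner ℝ (grad Ω ((riesz hΩ hT S φ).1 t))
        (grad Ω ((riesz hΩ hT S φ).1 t))
      = (∫ t in Ioo 0 T, (hm1Norm (dt φ t) ^ 2 + ‖grad Ω (incl φ t)‖ ^ 2))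
        - 2 * ∫ t in Ioo 0 T, dt φ t (incl φ t) := by
    rw [← integral_const_mul,
      ← integral_sub hi ((integrable_dual_apply (dt φ) (incl φ)).const_mul 2)]
    refine integral_congr_ae ?_
    filter_upwards [riesz_fst_ae hΩ hT S φ] with t ht
    rw [ht, map_sub, real_inner_self_eq_norm_sq, norm_sub_sq_real, hm1Norm_eq hC hS,
      real_inner_comm, hS]
    ring
  have h2 : inner ℝ (riesz hΩ hT S φ).2 (riesz hΩ hT S φ).2 = 4 * ‖valAt φ T‖ ^ 2 := by
    change inner ℝ ((2 : ℝ) • valAt φ T) ((2 : ℝ) • valAt φ T) = _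
    rw [real_inner_smul_left, real_inner_smul_right, real_inner_self_eq_norm_sq]; ring
  rw [norm_eq_sqrt_real_inner, inner_zEmb, h1, h2, ysNorm]
  congr 1
  linarith [norm_valAt_sq hΩ hT φ]

/-- If `φ = A⁻¹∂ₜφ` and `φ(T) = 0`, then `2 ‖φ‖_X² = 2 ∫ ⟨∂ₜφ, φ⟩ = -‖φ(0)‖² ≤ 0`, so that `φ`
vanishes. -/
theorem riesz_injective {C : ℝ} (hC : ∀ v : H10 Ω, ‖v‖ ≤ C * ‖grad Ω v‖)
    {S : Hm1 Ω →L[ℝ] H10 Ω} (hS : ∀ Φ v, inner ℝ (grad Ω (S Φ)) (grad Ω v) = Φ v)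
    (hΩ : IsOpen Ω) (hT : 0 < T) : Function.Injective (riesz (Ω := Ω) hΩ hT S) := by
  rw [injective_iff_map_eq_zero]
  intro φ hφ
  have h1 : ∀ᵐ t ∂(volume.restrict (Ioo 0 T)), incl φ t = S (dt φ t) := by
    have h := riesz_fst_ae hΩ hT S φ
    rw [hφ] at h
    filter_upwards [h, Lp.coeFn_zero (H10 Ω) 2 (volume.restrict (Ioo 0 T))] with t h2 h3
    exact sub_eq_zero.1 (h2.symm.trans h3)
  have hT0 : valAt φ T = 0 := by
    have h : (2 : ℝ) • valAt φ T = 0 := congrArg Prod.snd hφ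
    exact (smul_eq_zero.1 h).resolve_left two_ne_zero
  have h2 : ∫ t in Ioo 0 T, dt φ t (incl φ t) = ∫ t in Ioo 0 T, ‖grad Ω (incl φ t)‖ ^ 2 := by
    refine integral_congr_ae ?_
    filter_upwards [h1] with t ht
    rw [← hS, ← ht, real_inner_self_eq_norm_sq]
  have h3 := norm_valAt_sq hΩ hT φ
  rw [hT0, norm_zero, h2] at h3
  have h4 : ∫ t in Ioo 0 T, ‖grad Ω (incl φ t)‖ ^ 2 = 0 :=
    le_antisymm (by nlinarith [sq_nonneg ‖valAt φ 0‖]) (integral_grad_sq_nonneg _)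
  have hi : IntegrableOn (fun t => ‖grad Ω (incl φ t)‖ ^ 2) (Ioo 0 T) :=
    ((grad Ω).comp_memLp' (Lp.memLp (incl φ))).integrable_norm_pow (by norm_num)
  rw [integral_eq_zero_iff_of_nonneg (fun _ => sq_nonneg _) hi] at h4
  have h5 : ∀ᵐ t ∂(volume.restrict (Ioo 0 T)), grad Ω (incl φ t) = 0 := by
    filter_upwards [h4] with t ht
    simpa using ht
  refine Subtype.ext (Prod.ext ?_ ?_)
  · refine (Lp.eq_zero_iff_ae_eq_zero).2 ?_
    filter_upwards [h5] with t ht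
    have := hC (incl φ t)
    rw [ht, norm_zero, mul_zero] at this
    exact norm_le_zero_iff.1 this
  · refine (Lp.eq_zero_iff_ae_eq_zero).2 ?_
    filter_upwards [h1, h5] with t ht ht'
    refine ContinuousLinearMap.ext fun v => ?_
    change dt φ t v = 0
    rw [← hS, ← ht, ht', inner_zero_left]

/-! ### Density of the range -/

/-- If `B_Z(v, ·)` vanishes on `η ⊗ w` for all test functions `η` on `(0,T)`, then `v` solves the
homogeneous heat equation. -/
theorem isWeakTimeDeriv_of_BZ_eq_zero (hΩ : IsOpen Ω) (hT : 0 < T) {v : Z Ω T}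
    (h : ∀ φ : Y Ω T, BZ v φ = 0) : IsWeakTimeDeriv v.1 ((-negLaplacian Ω).compLp v.1) := by
  intro η hη
  have hi1 : IntegrableOn (fun t => deriv η t • toHm1 Ω (v.1 t)) (Ioo 0 T) :=
    hη.deriv.integrable_smul
      (((toHm1 Ω).comp_memLp' (Lp.memLp v.1)).integrable (by norm_num))
  have hi2 : IntegrableOn (fun t => η t • (-negLaplacian Ω).compLp v.1 t) (Ioo 0 T) :=
    hη.integrable_smul ((Lp.memLp ((-negLaplacian Ω).compLp v.1)).integrable (by norm_num))
  refine ContinuousLinearMap.ext fun w => ?_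
  obtain ⟨φ, h1, h2, h3⟩ := exists_tensor hΩ hT hη.smooth w
  have h4 := h φ
  rw [BZ, h3 T ⟨hT.le, le_rfl⟩, hη.eq_zero (t := T) (by simp), zero_smul, inner_zero_right,
    zero_add] at h4
  rw [neg_apply, ContinuousLinearMap.integral_apply hi1, ContinuousLinearMap.integral_apply hi2,
    ← add_eq_zero_iff_eq_neg, ← integral_add (hi1.apply_continuousLinearMap w)
      (hi2.apply_continuousLinearMap w), ← neg_eq_zero, ← integral_neg]
  refine Eq.trans (integral_congr_ae ?_) h4
  filter_upwards [h1, h2, (-negLaplacian Ω).coeFn_compLp v.1] with t ht1 ht2 ht3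
  rw [ht1, ht2, ht3, map_smul, real_inner_smul_left]
  simp only [smul_apply, neg_apply, toHm1_apply, negLaplacian_apply, smul_eq_mul]
  rw [real_inner_comm (toL2 Ω w), real_inner_comm (grad Ω w)]
  ring

/-- The form `B_Z` is nondegenerate in its first argument: an annihilating `v` is a solution of the
homogeneous heat equation with `v(0) = 0`, hence vanishes by the energy identity. -/
theorem eq_zero_of_BZ_eq_zero (hd : 1 ≤ d) (hΩ : IsOpen Ω) (hΩb : Bornology.IsBounded Ω)
    (hT : 0 < T) {v : Z Ω T} (h : ∀ φ : Y Ω T, BZ v φ = 0) : v = 0 := by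
  let y : Y Ω T := ⟨(v.1, (-negLaplacian Ω).compLp v.1), isWeakTimeDeriv_of_BZ_eq_zero hΩ hT h⟩
  have hdt : ∀ᵐ t ∂(volume.restrict (Ioo 0 T)), ∀ x : H10 Ω,
      dt y t x = -inner ℝ (grad Ω (v.1 t)) (grad Ω x) := by
    filter_upwards [(-negLaplacian Ω).coeFn_compLp v.1] with t ht x
    change (-negLaplacian Ω).compLp v.1 t x = _
    rw [ht]; rfl
  have hB : ∀ φ : Y Ω T,
      inner ℝ (v.2 - valAt y T) (valAt φ T) + inner ℝ (valAt y 0) (valAt φ 0) = 0 := by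
    intro φ
    have h1 := h φ
    have h2 := integral_dt_add_dt hΩ hT φ y
    have h3 : ∫ t in Ioo 0 T, (-(dt φ t) (v.1 t) + inner ℝ (grad Ω (incl φ t)) (grad Ω (v.1 t)))
        = -∫ t in Ioo 0 T, (dt φ t (incl y t) + dt y t (incl φ t)) := by
      rw [← integral_neg]
      refine integral_congr_ae ?_
      filter_upwards [hdt] with t ht
      rw [ht, real_inner_comm]
      change _ = -(dt φ t (v.1 t) + _)
      ring
    rw [BZ, h3, h2, real_inner_comm, real_inner_comm (valAt y T), real_inner_comm (valAt y 0)] at h1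
    rw [inner_sub_left, real_inner_comm]
    linarith
  have hT' : T ∈ Icc 0 T := ⟨hT.le, le_rfl⟩
  have h0' : (0 : ℝ) ∈ Icc 0 T := ⟨le_rfl, hT.le⟩
  -- testing with `φ(t) = t w`
  have hvT : v.2 = valAt y T := by
    refine sub_eq_zero.1 (eq_zero_of_forall_inner_toL2 hΩ fun w => ?_)
    obtain ⟨φ, -, -, h3⟩ := exists_tensor hΩ hT contDiff_id w
    have := hB φ
    rw [h3 T hT', h3 0 h0', id, id, zero_smul, inner_zero_right, add_zero, real_inner_smul_right]
      at this
    exact (mul_eq_zero.1 this).resolve_left hT.ne'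
  -- testing with `φ(t) = (T - t) w`
  have hv0 : valAt y 0 = 0 := by
    refine eq_zero_of_forall_inner_toL2 hΩ fun w => ?_
    obtain ⟨φ, -, -, h3⟩ := exists_tensor hΩ hT (contDiff_const.sub contDiff_id : ContDiff ℝ ∞
      (fun t : ℝ => T - id t)) w
    have := hB φ
    rw [h3 T hT', h3 0 h0', id, id, sub_self, zero_smul, inner_zero_right, zero_add, sub_zero,
      real_inner_smul_right] at this
    exact (mul_eq_zero.1 this).resolve_left hT.ne'
  have he := norm_valAt_sq hΩ hT y
  have h4 : ∫ t in Ioo 0 T, dt y t (incl y t) = -∫ t in Ioo 0 T, ‖grad Ω (v.1 t)‖ ^ 2 := by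
    rw [← integral_neg]
    refine integral_congr_ae ?_
    filter_upwards [hdt] with t ht
    rw [ht]
    change -inner ℝ (grad Ω (v.1 t)) (grad Ω (v.1 t)) = _
    rw [real_inner_self_eq_norm_sq]
  rw [hv0, norm_zero, h4, ← hvT] at he
  have h5 := integral_grad_sq_nonneg v.1
  have h6 : zNorm v = 0 := by
    have h7 : (∫ t in Ioo 0 T, ‖grad Ω (v.1 t)‖ ^ 2) + 1 / 2 * ‖v.2‖ ^ 2 = 0 := by linarith
    rw [zNorm, xNorm, Real.sq_sqrt h5, h7, Real.sqrt_zero]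
  obtain ⟨K, hK⟩ := antilipschitz_zEmb (Ω := Ω) (T := T) hd hΩb
  refine (map_eq_zero_iff (zEmb Ω T) hK.injective).1 ?_
  rw [← norm_eq_zero, norm_zEmb, h6]

/-- The range of `riesz` is dense in `Z`. -/
theorem zEmb_mem_closure_range (hd : 1 ≤ d) (hΩ : IsOpen Ω) (hΩb : Bornology.IsBounded Ω)
    (hT : 0 < T) {S : Hm1 Ω →L[ℝ] H10 Ω}
    (hS : ∀ Φ v, inner ℝ (grad Ω (S Φ)) (grad Ω v) = Φ v) (v : Z Ω T) :
    zEmb Ω T v ∈ closure (range ((zEmb Ω T).toLinearMap ∘ₗ riesz hΩ hT S)) := by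
  obtain ⟨K, hK⟩ := antilipschitz_zEmb (Ω := Ω) (T := T) hd hΩb
  have hcl : IsClosed (range (zEmb Ω T)) := hK.isClosed_range (zEmb Ω T).uniformContinuous
  set f := (zEmb Ω T).toLinearMap ∘ₗ riesz hΩ hT S
  let U : Submodule ℝ (WithLp 2 (L2t T (L2vec Ω) × L2 Ω)) := f.range.topologicalClosure
  have hUc : IsClosed (U : Set (WithLp 2 (L2t T (L2vec Ω) × L2 Ω))) :=
    Submodule.isClosed_topologicalClosure _
  have : CompleteSpace U := hUc.completeSpace_coe
  -- the image of `Z` is closed, so the component of `v` orthogonal to `U` comes from `Z` as well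
  have hsub : (U : Set (WithLp 2 (L2t T (L2vec Ω) × L2 Ω))) ⊆ range (zEmb Ω T) := by
    refine closure_minimal ?_ hcl
    rintro _ ⟨φ, rfl⟩
    exact ⟨_, rfl⟩
  obtain ⟨p, hp, q, hq, hpq⟩ := U.exists_add_mem_mem_orthogonal (zEmb Ω T v)
  obtain ⟨z, hz⟩ := hsub hp
  have h0 : v - z = 0 := by
    refine eq_zero_of_BZ_eq_zero hd hΩ hΩb hT fun φ => ?_
    rw [BZ_eq_inner hS hΩ hT, map_sub, hz, hpq, add_sub_cancel_left, real_inner_comm]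
    exact (Submodule.mem_orthogonal _ q).1 hq _ (f.range.le_topologicalClosure ⟨φ, rfl⟩)
  rw [sub_eq_zero.1 h0, hz]
  exact hp

end Main

/-! ### The inf-sup identities and the energy norm -/

section Conclusion

variable {d : ℕ} {Ω : Set (E d)} {T : ℝ}

theorem nontrivial_L2 (hΩ : IsOpen Ω) (hΩb : Bornology.IsBounded Ω) (hΩne : Ω.Nonempty) :
    Nontrivial (L2 Ω) := by
  have hpos : 0 < volume Ω := hΩ.measure_pos volume hΩne
  refine ⟨indicatorConstLp 2 (μ := volume.restrict Ω) hΩ.measurableSet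
    (by simpa using hΩb.measure_lt_top.ne) (1 : ℝ), 0, fun h => ?_⟩
  have h1 := congrArg norm h
  rw [norm_indicatorConstLp (by simp) (by simp), norm_zero, norm_one, one_mul] at h1
  have h2 : 0 < (volume.restrict Ω).real Ω := by
    rw [measureReal_restrict_apply_self]
    exact ENNReal.toReal_pos hpos.ne' hΩb.measure_lt_top.ne
  exact (Real.rpow_pos_of_pos h2 _).ne' h1

/-- The data functional of the heat equation is `B_Z((u, u(T)), ·)`. -/
theorem IsHeatSolution.BZ_eq (hΩ : IsOpen Ω) (hT : 0 < T) {f : L2t T (Hm1 Ω)} {u₀ : L2 Ω}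
    {u : Y Ω T} (hu : IsHeatSolution f u₀ u) (φ : Y Ω T) :
    BZ (incl u, valAt u T) φ
      = (∫ t in Ioo 0 T, f t (incl φ t)) + inner ℝ u₀ (valAt φ 0) := by
  -- by separability of `H¹₀(Ω)`, one null set serves all `v`
  have hae : ∀ᵐ t ∂(volume.restrict (Ioo 0 T)), ∀ v : H10 Ω,
      dt u t v + inner ℝ (grad Ω (incl u t)) (grad Ω v) = f t v := by
    have h1 := ae_all_iff.2 fun n => hu.1 (TopologicalSpace.denseSeq (H10 Ω) n)
    filter_upwards [h1] with t ht v
    have hcl : IsClosed {v : H10 Ω |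
        dt u t v + inner ℝ (grad Ω (incl u t)) (grad Ω v) = f t v} :=
      isClosed_eq ((dt u t).continuous.add (continuous_const.inner (grad Ω).continuous))
        (f t).continuous
    exact closure_minimal (range_subset_iff.2 ht) hcl
      (TopologicalSpace.denseRange_denseSeq (H10 Ω) v)
  have h1 := integral_dt_add_dt hΩ hT φ u
  have hi : IntegrableOn (fun t => dt φ t (incl u t) + dt u t (incl φ t)) (Ioo 0 T) :=
    (integrable_dual_apply _ _).add (integrable_dual_apply _ _)
  have h2 : ∫ t in Ioo 0 T, (-(dt φ t) (incl u t)
        + inner ℝ (grad Ω (incl φ t)) (grad Ω (incl u t)))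
      = (∫ t in Ioo 0 T, f t (incl φ t))
        - ∫ t in Ioo 0 T, (dt φ t (incl u t) + dt u t (incl φ t)) := by
    rw [← integral_sub (integrable_dual_apply f (incl φ)) hi]
    refine integral_congr_ae ?_
    filter_upwards [hae] with t ht
    rw [← ht, real_inner_comm]
    ring
  rw [BZ, h2, h1, ← hu.2, real_inner_comm, real_inner_comm (valAt φ 0)]
  ring

end Conclusion

end HeatEnergy

theorem mainTheorem1 (d : ℕ) (hd : 1 ≤ d) (Ω : Set (HeatEnergy.E d)) (hΩ : IsOpen Ω)
    (hΩb : Bornology.IsBounded Ω) (hΩne : Ω.Nonempty) (T : ℝ) (hT : 0 < T) :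
    (∀ φ : HeatEnergy.Y Ω T, ∃ c : ℝ → HeatEnergy.L2 Ω, HeatEnergy.IsContRep φ c) ∧
    (∀ v : HeatEnergy.Z Ω T,
      IsLUB {r : ℝ | ∃ φ : HeatEnergy.Y Ω T, φ ≠ 0 ∧
        r = HeatEnergy.BZ v φ / HeatEnergy.ysNorm φ} (HeatEnergy.zNorm v)) ∧
    (∀ φ : HeatEnergy.Y Ω T,
      IsLUB {r : ℝ | ∃ v : HeatEnergy.Z Ω T, v ≠ 0 ∧
        r = HeatEnergy.BZ v φ / HeatEnergy.zNorm v} (HeatEnergy.ysNorm φ)) ∧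
    (∀ (f : HeatEnergy.L2t T (HeatEnergy.Hm1 Ω)) (u₀ : HeatEnergy.L2 Ω) (u : HeatEnergy.Y Ω T),
      HeatEnergy.IsHeatSolution f u₀ u →
      HeatEnergy.energyNorm u = HeatEnergy.zNorm (HeatEnergy.incl u, HeatEnergy.valAt u T) ∧
      IsLUB {r : ℝ | ∃ φ : HeatEnergy.Y Ω T, φ ≠ 0 ∧
        r = ((∫ t in Set.Ioo 0 T, (f t) (HeatEnergy.incl φ t)) + inner ℝ u₀ (HeatEnergy.valAt φ 0))
          / HeatEnergy.ysNorm φ} (HeatEnergy.energyNorm u)) := by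
  obtain ⟨C, hC0, hC⟩ := HeatEnergy.exists_norm_le_grad hd hΩb
  obtain ⟨S, hS⟩ := HeatEnergy.exists_inverse_negLaplacian hd hΩb
  obtain ⟨K, hK⟩ := HeatEnergy.antilipschitz_zEmb (Ω := Ω) (T := T) hd hΩb
  have hL2 := HeatEnergy.nontrivial_L2 hΩ hΩb hΩne
  have hZ : Nontrivial (HeatEnergy.Z Ω T) := inferInstance
  set ι := HeatEnergy.zEmb Ω T
  set R := HeatEnergy.riesz (Ω := Ω) hΩ hT S
  have hinj : Function.Injective (ι.toLinearMap ∘ₗ R) :=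
    hK.injective.comp (HeatEnergy.riesz_injective hC hS hΩ hT)
  have hdense := HeatEnergy.zEmb_mem_closure_range hd hΩ hΩb hT hS
  -- `Y` is nontrivial because the image of `riesz` is dense in the nontrivial space `Z`
  have hY : Nontrivial (HeatEnergy.Y Ω T) := by
    by_contra hn
    rw [not_nontrivial_iff_subsingleton] at hn
    obtain ⟨v, hv⟩ := exists_ne (0 : HeatEnergy.Z Ω T)
    have h1 : range (ι.toLinearMap ∘ₗ R) ⊆ {0} := by
      rintro _ ⟨φ, rfl⟩
      rw [Subsingleton.elim φ 0, map_zero]; rfl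
    have h2 : ι v = 0 := closure_minimal h1 isClosed_singleton (hdense v)
    exact hv ((map_eq_zero_iff ι hK.injective).1 h2)
  have hB : ∀ v φ, HeatEnergy.BZ v φ = inner ℝ (ι v) (ι (R φ)) :=
    HeatEnergy.BZ_eq_inner hS hΩ hT
  have hYn : ∀ φ, ‖ι (R φ)‖ = HeatEnergy.ysNorm φ := HeatEnergy.norm_zEmb_riesz hC hS hΩ hT
  have hZn : ∀ v, ‖ι v‖ = HeatEnergy.zNorm v := HeatEnergy.norm_zEmb
  have h2 : ∀ v : HeatEnergy.Z Ω T, IsLUB {r : ℝ | ∃ φ : HeatEnergy.Y Ω T, φ ≠ 0 ∧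
      r = HeatEnergy.BZ v φ / HeatEnergy.ysNorm φ} (HeatEnergy.zNorm v) := by
    intro v
    simp only [hB, ← hYn, ← hZn]
    exact HeatEnergy.isLUB_inner_div_norm hinj (hdense v)
  refine ⟨fun φ => ⟨_, HeatEnergy.isContRep_valAt hΩ hT φ⟩, h2, fun φ => ?_, fun f u₀ u hu => ?_⟩
  · simp only [hB, ← hYn, ← hZn, real_inner_comm (ι (R φ))]
    exact HeatEnergy.isLUB_inner_div_norm (f := ι.toLinearMap) hK.injective
      (subset_closure ⟨R φ, rfl⟩)
  · have he : HeatEnergy.energyNorm u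
        = HeatEnergy.zNorm (HeatEnergy.incl u, HeatEnergy.valAt u T) := by
      rw [HeatEnergy.energyNorm, HeatEnergy.zNorm, HeatEnergy.xNorm,
        Real.sq_sqrt (HeatEnergy.integral_grad_sq_nonneg _), add_comm]
    refine ⟨he, ?_⟩
    simp only [← hu.BZ_eq hΩ hT, he]
    exact h2 _
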